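/- For a positive integer $n$ write $[n]=\{1,\dots,n\}$. An isosceles trapezium is a non-degenerate convex quadrilateral in which two opposite sides have the same perpendicular bisector (so rectangles are included); trapezia are counted as figures, i.e. each is counted once and is determined by its set of four vertices. For real $a,b>0$ let $$f(a,b)=\frac{20a^6+25a^5b-7a^4b^2+28a^3b^3-20a^2b^4+3ab^5-b^6}{240\,a^5(a+b)^2(a^2+b^2)} .$$ Then the series $$\gamma=\frac{4}{15}+\sum_{a=2}^{\infty}\ \sum_{\substack{1\le b<a\\ \gcd(a,b)=1}} 2\bigl(3+(-1)^{a+b}\bigr)f(a,b)$$ converges, and, as $n\to\infty$, the number of isosceles trapezia with vertices in $[n]^2$ is $$\gamma n^5+O(n^4\log n).$$ -/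

import Mathlib

open Filter Asymptotics

/-- Four points `A`, `B`, `C`, `D` of the Euclidean plane are the vertices of a (non-degenerate)
isosceles trapezium with bases `AB` and `CD`: the two segments `AB` and `CD` have the same
perpendicular bisector (the axis of symmetry of the trapezium, which forces `AB` and `CD` to be
parallel), and the four points are not collinear. Rectangles are included. -/
def IsIsoscelesTrapezium (A B C D : EuclideanSpace ℝ (Fin 2)) : Prop :=
  A ≠ B ∧ C ≠ D ∧
    AffineSubspace.perpBisector A B = AffineSubspace.perpBisector C D ∧
    ¬ Collinear ℝ ({A, B, C, D} : Set (EuclideanSpace ℝ (Fin 2)))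

/-- The point of the Euclidean plane with the given integer coordinates. -/
noncomputable def latticePoint (p : ℤ × ℤ) : EuclideanSpace ℝ (Fin 2) :=
  !₂[(p.1 : ℝ), (p.2 : ℝ)]

/-- The grid `[n]² = {1, …, n}²`. -/
noncomputable def grid (n : ℕ) : Finset (ℤ × ℤ) :=
  Finset.Icc 1 (n : ℤ) ×ˢ Finset.Icc 1 (n : ℤ)

open Classical in
/-- The number of isosceles trapezia with vertices in `[n]²`. A trapezium is identified with its
set of four vertices (four points in convex position are the vertices of exactly one simple
quadrilateral), so each trapezium, in particular each rectangle, is counted once. -/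
noncomputable def numIsoscelesTrapezia (n : ℕ) : ℕ :=
  (((grid n).powersetCard 4).filter fun T =>
    ∃ A B C D : ℤ × ℤ, T = {A, B, C, D} ∧
      IsIsoscelesTrapezium (latticePoint A) (latticePoint B) (latticePoint C)
        (latticePoint D)).card

/-- The rational function `f(a, b)`. -/
noncomputable def trapeziumF (a b : ℝ) : ℝ :=
  (20 * a ^ 6 + 25 * a ^ 5 * b - 7 * a ^ 4 * b ^ 2 + 28 * a ^ 3 * b ^ 3 - 20 * a ^ 2 * b ^ 4
      + 3 * a * b ^ 5 - b ^ 6) /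
    (240 * a ^ 5 * (a + b) ^ 2 * (a ^ 2 + b ^ 2))

/-- The inner sum, over `1 ≤ b < a` with `gcd(a, b) = 1`, of `2 (3 + (-1)^(a+b)) f(a, b)`. -/
noncomputable def trapeziumTerm (a : ℕ) : ℝ :=
  ∑ b ∈ (Finset.Ico 1 a).filter (fun b => Nat.gcd a b = 1),
    2 * (3 + (-1 : ℝ) ^ (a + b)) * trapeziumF a b

/-- The constant `γ`; the outer sum runs over `a = k + 2 ≥ 2`. -/
noncomputable def trapeziumGamma : ℝ :=
  4 / 15 + ∑' k : ℕ, trapeziumTerm (k + 2)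

/-! Divide one base of a lattice isosceles trapezium by its content to get a primitive vector `(u,
v)`. The bases are then `k (u, v)` and `l (u, v)`, and twice the vector joining their midpoints is
perpendicular to them, hence `s (-v, u)` with `s` an integer. The vertices are lattice points
exactly when `d = k - l` satisfies two parity conditions with `s`: both even, or both odd with `u +
v` even. After signs are fixed so that `k ≥ l ≥ 1` and `s ≥ 1`, a trapezium that is not a rectangle
has exactly one such frame.

For a fixed shape the number of positions is `(n - W)₊ (n - H)₊`, where `W` and `H` are the sides of
the bounding box. This is `boxWeight`, a function of `|u|`, `|v|` and `l`, `d / 2`, `s / 2`.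
Rectangles are the shapes with `d = 0`. Admitting them gives an upper bound
(`numIsoscelesTrapezia_le_sum`), omitting them a lower bound (`sum_le_numIsoscelesTrapezia`). The
two bounds differ only by a shift of the sample points in a Riemann sum, so both obey the same
asymptotics.

For a direction with `0 ≤ b ≤ a`, each parity class is a Riemann sum with unit cells for the
integral of `boxWeight` over the octant. The weight has Lipschitz constant `O(n a)` and is supported
in a cube of side `n / a`, so the error is `O(n ^ 4 / a ^ 2)` (`abs_sum_boxWeight_sub_le`). The
integral is computed exactly (`coneIntegral_boxWeight`): the octant is cut into seven simplicial
cones on which `W` and `H` are linear and one of them dominates, and each cone contributes an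
elementary integral. The total is `n ^ 5 * f(a, b) / 2`.

The eight symmetries of the square turn the sum over primitive directions into the axis and diagonal
terms, which give `4 / 15`, and the sum over `b < a`. The errors add up to `n ^ 4` times a harmonic
sum, which produces the logarithm. The inner sums of the series are at most `8 / a ^ 2`, so the
series converges and truncating it at `a ≤ n` costs only `O(n ^ 4)`. -/

/-! ### Integer equations for isosceles trapezia -/

theorem mem_perpBisector_latticePoint (A B : ℤ × ℤ) (x : EuclideanSpace ℝ (Fin 2)) :
    x ∈ AffineSubspace.perpBisector (latticePoint A) (latticePoint B) ↔
      ((B.1 : ℝ) - A.1) * (2 * x 0 - A.1 - B.1) + ((B.2 : ℝ) - A.2) * (2 * x 1 - A.2 - B.2)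
        = 0 := by
  rw [AffineSubspace.mem_perpBisector_iff_dist_eq, EuclideanSpace.dist_eq, EuclideanSpace.dist_eq,
    Real.sqrt_inj (by positivity) (by positivity)]
  simp only [Fin.sum_univ_two, Real.dist_eq, sq_abs, latticePoint]
  simp only [Matrix.cons_val_zero, Matrix.cons_val_one]
  constructor <;> intro h <;> linarith

theorem latticePoint_apply_zero (A : ℤ × ℤ) : latticePoint A 0 = A.1 := by
  simp [latticePoint]

theorem latticePoint_apply_one (A : ℤ × ℤ) : latticePoint A 1 = A.2 := by
  simp [latticePoint]

/-- Integer equations satisfied by the vertices of an isosceles trapezium. -/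
theorem IsIsoscelesTrapezium.equations {A B C D : ℤ × ℤ}
    (h : IsIsoscelesTrapezium (latticePoint A) (latticePoint B) (latticePoint C)
      (latticePoint D)) :
    A ≠ B ∧ C ≠ D ∧
      (B.1 - A.1) * (D.2 - C.2) - (B.2 - A.2) * (D.1 - C.1) = 0 ∧
      (B.1 - A.1) * (C.1 + D.1 - A.1 - B.1) + (B.2 - A.2) * (C.2 + D.2 - A.2 - B.2) = 0 ∧
      (B.1 - A.1) * (C.2 - A.2) - (B.2 - A.2) * (C.1 - A.1) ≠ 0 := by
  obtain ⟨hAB, hCD, hp, hcol⟩ := h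
  have hAB' : A ≠ B := fun h => hAB (by rw [h])
  have hpar : ((B.1 : ℝ) - A.1) * (D.2 - C.2) - ((B.2 : ℝ) - A.2) * (D.1 - C.1) = 0 := by
    -- Two points of the common bisector are tested against `CD`: the midpoint of `AB`, and that
    -- midpoint moved by the quarter turn of `B - A`. The difference of the two equations says that
    -- the bases are parallel.
    have h1 : (!₂[((A.1 : ℝ) + B.1) / 2, ((A.2 : ℝ) + B.2) / 2] : EuclideanSpace ℝ (Fin 2)) ∈
        AffineSubspace.perpBisector (latticePoint A) (latticePoint B) := by
      rw [mem_perpBisector_latticePoint]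
      simp only [Matrix.cons_val_zero, Matrix.cons_val_one]
      ring
    have h2 : (!₂[((A.1 : ℝ) + B.1) / 2 - (B.2 - A.2), ((A.2 : ℝ) + B.2) / 2 + (B.1 - A.1)] :
        EuclideanSpace ℝ (Fin 2)) ∈
        AffineSubspace.perpBisector (latticePoint A) (latticePoint B) := by
      rw [mem_perpBisector_latticePoint]
      simp only [Matrix.cons_val_zero, Matrix.cons_val_one]
      ring
    rw [hp, mem_perpBisector_latticePoint] at h1 h2
    simp only [Matrix.cons_val_zero, Matrix.cons_val_one] at h1 h2
    linarith
  have hmid : ((B.1 : ℝ) - A.1) * (C.1 + D.1 - A.1 - B.1)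
      + ((B.2 : ℝ) - A.2) * (C.2 + D.2 - A.2 - B.2) = 0 := by
    have h1 : (!₂[((C.1 : ℝ) + D.1) / 2, ((C.2 : ℝ) + D.2) / 2] : EuclideanSpace ℝ (Fin 2)) ∈
        AffineSubspace.perpBisector (latticePoint C) (latticePoint D) := by
      rw [mem_perpBisector_latticePoint]
      simp only [Matrix.cons_val_zero, Matrix.cons_val_one]
      ring
    rw [← hp, mem_perpBisector_latticePoint] at h1
    simp only [Matrix.cons_val_zero, Matrix.cons_val_one] at h1
    linarith
  refine ⟨hAB', fun h => hCD (by rw [h]), by exact_mod_cast hpar, by exact_mod_cast hmid, ?_⟩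
  intro h0
  apply hcol
  have h0' : ((B.1 : ℝ) - A.1) * (C.2 - A.2) - ((B.2 : ℝ) - A.2) * (C.1 - A.1) = 0 := by
    exact_mod_cast h0
  have hN : ((B.1 : ℝ) - A.1) ^ 2 + ((B.2 : ℝ) - A.2) ^ 2 ≠ 0 := by
    intro hz
    apply hAB'
    have e1 : ((B.1 : ℝ) - A.1) = 0 := by nlinarith [sq_nonneg ((B.1 : ℝ) - A.1), sq_nonneg ((B.2 : ℝ) - A.2)]
    have e2 : ((B.2 : ℝ) - A.2) = 0 := by nlinarith [sq_nonneg ((B.1 : ℝ) - A.1), sq_nonneg ((B.2 : ℝ) - A.2)]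
    have e1' : B.1 = A.1 := by exact_mod_cast sub_eq_zero.1 e1
    have e2' : B.2 = A.2 := by exact_mod_cast sub_eq_zero.1 e2
    exact Prod.ext e1'.symm e2'.symm
  have key : ∀ E : ℤ × ℤ, ((B.1 : ℝ) - A.1) * (E.2 - A.2) - ((B.2 : ℝ) - A.2) * (E.1 - A.1) = 0 →
      ∃ r : ℝ, latticePoint E = r • (latticePoint B - latticePoint A) +ᵥ latticePoint A := by
    intro E hE
    refine ⟨(((B.1 : ℝ) - A.1) * (E.1 - A.1) + ((B.2 : ℝ) - A.2) * (E.2 - A.2)) /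
      (((B.1 : ℝ) - A.1) ^ 2 + ((B.2 : ℝ) - A.2) ^ 2), ?_⟩
    ext i
    fin_cases i
    · simp only [vadd_eq_add, PiLp.add_apply, PiLp.smul_apply, PiLp.sub_apply, smul_eq_mul,
        Fin.zero_eta, latticePoint_apply_zero]
      field_simp
      linear_combination ((A.2 : ℝ) - B.2) * hE
    · simp only [vadd_eq_add, PiLp.add_apply, PiLp.smul_apply, PiLp.sub_apply, smul_eq_mul,
        Fin.mk_one, latticePoint_apply_one]
      field_simp
      linear_combination (-(A.1 : ℝ) + B.1) * hE
  rw [collinear_iff_of_mem (p₀ := latticePoint A) (by simp)]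
  refine ⟨latticePoint B - latticePoint A, ?_⟩
  intro p hp'
  simp only [Set.mem_insert_iff, Set.mem_singleton_iff] at hp'
  rcases hp' with rfl | rfl | rfl | rfl
  · exact key _ (by ring)
  · exact key _ (by ring)
  · exact key _ h0'
  · exact key _ (by linear_combination h0' + hpar)

/-- Two disjoint lattice segments on the multiples of one vector with midpoints on a common
perpendicular span an isosceles trapezium. -/
theorem isIsoscelesTrapezium_of_equations {A B C D : ℤ × ℤ} {u v k l : ℤ}
    (hk : k ≠ 0) (hl : l ≠ 0) (hB1 : B.1 - A.1 = k * u) (hB2 : B.2 - A.2 = k * v)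
    (hD1 : D.1 - C.1 = l * u) (hD2 : D.2 - C.2 = l * v)
    (hmid : u * (C.1 + D.1 - A.1 - B.1) + v * (C.2 + D.2 - A.2 - B.2) = 0)
    (hcross : u * (C.2 - A.2) - v * (C.1 - A.1) ≠ 0) :
    IsIsoscelesTrapezium (latticePoint A) (latticePoint B) (latticePoint C) (latticePoint D) := by
  have huv : ¬ (u = 0 ∧ v = 0) := by
    rintro ⟨rfl, rfl⟩
    simp at hcross
  have ne_of : ∀ (P Q : ℤ × ℤ) (m : ℤ), m ≠ 0 → Q.1 - P.1 = m * u → Q.2 - P.2 = m * v →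
      latticePoint P ≠ latticePoint Q := by
    intro P Q m hm h1 h2 h
    apply huv
    have e1 := congrArg (fun x : EuclideanSpace ℝ (Fin 2) => x 0) h
    have e2 := congrArg (fun x : EuclideanSpace ℝ (Fin 2) => x 1) h
    simp only [latticePoint_apply_zero, latticePoint_apply_one, Int.cast_inj] at e1 e2
    constructor
    · have : m * u = 0 := by omega
      simpa [hm] using this
    · have : m * v = 0 := by omega
      simpa [hm] using this
  have hB1' : ((B.1 : ℝ) - A.1) = k * u := by exact_mod_cast hB1
  have hB2' : ((B.2 : ℝ) - A.2) = k * v := by exact_mod_cast hB2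
  have hD1' : ((D.1 : ℝ) - C.1) = l * u := by exact_mod_cast hD1
  have hD2' : ((D.2 : ℝ) - C.2) = l * v := by exact_mod_cast hD2
  have hmid' : (u : ℝ) * (C.1 + D.1 - A.1 - B.1) + v * (C.2 + D.2 - A.2 - B.2) = 0 := by
    exact_mod_cast hmid
  have hk' : (k : ℝ) ≠ 0 := by exact_mod_cast hk
  have hl' : (l : ℝ) ≠ 0 := by exact_mod_cast hl
  refine ⟨ne_of A B k hk hB1 hB2, ne_of C D l hl hD1 hD2, ?_, ?_⟩
  · ext x
    rw [mem_perpBisector_latticePoint, mem_perpBisector_latticePoint, hB1', hB2', hD1', hD2']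
    constructor
    · intro h
      have : (k : ℝ) * (u * (2 * x 0 - A.1 - B.1) + v * (2 * x 1 - A.2 - B.2)) = 0 := by
        linear_combination h
      have := (mul_eq_zero.1 this).resolve_left hk'
      linear_combination (l : ℝ) * this - l * hmid'
    · intro h
      have : (l : ℝ) * (u * (2 * x 0 - C.1 - D.1) + v * (2 * x 1 - C.2 - D.2)) = 0 := by
        linear_combination h
      have := (mul_eq_zero.1 this).resolve_left hl'
      linear_combination (k : ℝ) * this + k * hmid'
  · intro hcol
    rw [collinear_iff_of_mem (p₀ := latticePoint A) (by simp)] at hcol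
    obtain ⟨w, hw⟩ := hcol
    obtain ⟨r, hr⟩ := hw (latticePoint B) (by simp)
    obtain ⟨t, ht⟩ := hw (latticePoint C) (by simp)
    have r0 := congrArg (fun x : EuclideanSpace ℝ (Fin 2) => x 0) hr
    have r1 := congrArg (fun x : EuclideanSpace ℝ (Fin 2) => x 1) hr
    have t0 := congrArg (fun x : EuclideanSpace ℝ (Fin 2) => x 0) ht
    have t1 := congrArg (fun x : EuclideanSpace ℝ (Fin 2) => x 1) ht
    simp only [vadd_eq_add, PiLp.add_apply, PiLp.smul_apply, smul_eq_mul, latticePoint_apply_zero,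
      latticePoint_apply_one] at r0 r1 t0 t1
    have : (k : ℝ) * (u * (C.2 - A.2) - v * (C.1 - A.1)) = 0 := by
      have e : (k : ℝ) * (u * (C.2 - A.2) - v * (C.1 - A.1)) =
        (k * u) * (C.2 - A.2) - (k * v) * (C.1 - A.1) := by ring
      rw [e, ← hB1', ← hB2', r0, r1, t0, t1]
      ring
    have := (mul_eq_zero.1 this).resolve_left hk'
    apply hcross
    exact_mod_cast this

/-! ### Frames: existence, normalisation, uniqueness -/

/-- The segments `AB` and `CD` are the multiples `k` and `l` of the vector `(u, v)`, and twice the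
vector between their midpoints is the multiple `s` of `(-v, u)`. -/
def IsFrame (A B C D : ℤ × ℤ) (u v k l s : ℤ) : Prop :=
  B.1 - A.1 = k * u ∧ B.2 - A.2 = k * v ∧ D.1 - C.1 = l * u ∧ D.2 - C.2 = l * v ∧
    2 * (C.1 - A.1) = (k - l) * u - s * v ∧ 2 * (C.2 - A.2) = (k - l) * v + s * u

theorem IsFrame.swap_first {A B C D : ℤ × ℤ} {u v k l s : ℤ} (h : IsFrame A B C D u v k l s) :
    IsFrame B A C D u v (-k) l s := by
  obtain ⟨h1, h2, h3, h4, h5, h6⟩ := h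
  refine ⟨?_, ?_, h3, h4, ?_, ?_⟩ <;> linarith

theorem IsFrame.swap_second {A B C D : ℤ × ℤ} {u v k l s : ℤ} (h : IsFrame A B C D u v k l s) :
    IsFrame A B D C u v k (-l) s := by
  obtain ⟨h1, h2, h3, h4, h5, h6⟩ := h
  refine ⟨h1, h2, ?_, ?_, ?_, ?_⟩ <;> linarith

theorem IsFrame.swap_bases {A B C D : ℤ × ℤ} {u v k l s : ℤ} (h : IsFrame A B C D u v k l s) :
    IsFrame C D A B u v l k (-s) := by
  obtain ⟨h1, h2, h3, h4, h5, h6⟩ := h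
  refine ⟨h3, h4, h1, h2, ?_, ?_⟩ <;> linarith

theorem IsFrame.neg {A B C D : ℤ × ℤ} {u v k l s : ℤ} (h : IsFrame A B C D u v k l s) :
    IsFrame A B C D (-u) (-v) (-k) (-l) (-s) := by
  obtain ⟨h1, h2, h3, h4, h5, h6⟩ := h
  refine ⟨?_, ?_, ?_, ?_, ?_, ?_⟩ <;> linarith

theorem IsCoprime.exists_eq_mul_of_mul_eq {u v x y : ℤ} (h : IsCoprime u v) (hxy : u * y = v * x) :
    ∃ m, x = m * u ∧ y = m * v := by
  obtain ⟨α, β, hab⟩ := h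
  refine ⟨α * x + β * y, ?_, ?_⟩
  · linear_combination (-x) * hab - β * hxy
  · linear_combination (-y) * hab + α * hxy

/-- Since `(u, v)` is primitive, an integer vector parallel to it is an integer multiple of it,
which yields `l`; the vector `C + D - A - B` is perpendicular to it, hence an integer multiple of
`(-v, u)`, which yields `s`. Non-collinearity excludes `s = 0`. -/
theorem exists_isFrame {A B C D : ℤ × ℤ} (hAB : A ≠ B) (hCD : C ≠ D)
    (hpar : (B.1 - A.1) * (D.2 - C.2) - (B.2 - A.2) * (D.1 - C.1) = 0)
    (hmid : (B.1 - A.1) * (C.1 + D.1 - A.1 - B.1) + (B.2 - A.2) * (C.2 + D.2 - A.2 - B.2) = 0)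
    (hcross : (B.1 - A.1) * (C.2 - A.2) - (B.2 - A.2) * (C.1 - A.1) ≠ 0) :
    ∃ u v k l s, IsCoprime u v ∧ k ≠ 0 ∧ l ≠ 0 ∧ s ≠ 0 ∧ IsFrame A B C D u v k l s := by
  have hg : 0 < Int.gcd (B.1 - A.1) (B.2 - A.2) := by
    rw [Int.gcd_pos_iff]
    by_contra! h
    exact hAB (Prod.ext (by omega) (by omega))
  obtain ⟨u, v, hcop, h1, h2⟩ := Int.exists_gcd_one hg
  obtain ⟨k, hk⟩ : ∃ k : ℤ, k = Int.gcd (B.1 - A.1) (B.2 - A.2) := ⟨_, rfl⟩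
  have hk0 : k ≠ 0 := by omega
  rw [← hk, mul_comm] at h1 h2
  have hc : IsCoprime u v := Int.isCoprime_iff_gcd_eq_one.2 hcop
  rw [h1, h2] at hpar hmid hcross
  have hpar' : u * (D.2 - C.2) = v * (D.1 - C.1) :=
    mul_left_cancel₀ hk0 (by linear_combination hpar)
  have hmid' : u * -(C.1 + D.1 - A.1 - B.1) = v * (C.2 + D.2 - A.2 - B.2) :=
    mul_left_cancel₀ hk0 (by linear_combination -hmid)
  obtain ⟨l, hl1, hl2⟩ := hc.exists_eq_mul_of_mul_eq hpar'
  obtain ⟨s, hs1, hs2⟩ := hc.exists_eq_mul_of_mul_eq hmid'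
  have h5 : 2 * (C.1 - A.1) = (k - l) * u - s * v := by linarith
  have h6 : 2 * (C.2 - A.2) = (k - l) * v + s * u := by linarith
  refine ⟨u, v, k, l, s, hc, hk0, ?_, ?_, by linarith, by linarith, hl1, hl2, h5, h6⟩
  · rintro rfl
    exact hCD (Prod.ext (by linarith) (by linarith))
  · rintro rfl
    apply hcross
    have : 2 * (k * u * (C.2 - A.2) - k * v * (C.1 - A.1)) = 0 := by
      linear_combination (k * u) * h6 - (k * v) * h5
    omega

open Classical in
/-- A frame can be normalised without changing its set of vertices. -/
theorem IsFrame.normalize {A B C D : ℤ × ℤ} {u v k l s : ℤ} (hc : IsCoprime u v) (hk : k ≠ 0)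
    (hl : l ≠ 0) (hs : s ≠ 0) (h : IsFrame A B C D u v k l s) :
    ∃ A' B' C' D' u' v' k' l' s', IsCoprime u' v' ∧ 1 ≤ l' ∧ l' ≤ k' ∧ 1 ≤ s' ∧
      IsFrame A' B' C' D' u' v' k' l' s' ∧
      ({A', B', C', D'} : Finset (ℤ × ℤ)) = {A, B, C, D} := by
  wlog hs0 : 0 < s generalizing u v k l s
  · exact this hc.neg_neg (neg_ne_zero.2 hk) (neg_ne_zero.2 hl) (neg_ne_zero.2 hs) h.neg
      (by omega)
  wlog hk0 : 0 < k generalizing A B k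
  · obtain ⟨A', B', C', D', u', v', k', l', s', h1, h2, h3, h4, h5, h6⟩ :=
      this (neg_ne_zero.2 hk) h.swap_first (by omega)
    exact ⟨A', B', C', D', u', v', k', l', s', h1, h2, h3, h4, h5, by
      rw [h6, Finset.insert_comm]⟩
  wlog hl0 : 0 < l generalizing C D l
  · obtain ⟨A', B', C', D', u', v', k', l', s', h1, h2, h3, h4, h5, h6⟩ :=
      this (neg_ne_zero.2 hl) h.swap_second (by omega)
    exact ⟨A', B', C', D', u', v', k', l', s', h1, h2, h3, h4, h5, by
      rw [h6, Finset.pair_comm]⟩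
  rcases le_or_gt l k with hlk | hlk
  · exact ⟨A, B, C, D, u, v, k, l, s, hc, hl0, hlk, hs0, h, rfl⟩
  -- Exchanging the bases reverses the sign of `s`. Reversing `(u, v)` restores it, and exchanging
  -- the ends of each base makes the two multiples positive again.
  · refine ⟨D, C, B, A, -u, -v, l, k, s, hc.neg_neg, hk0, hlk.le, hs0, ?_, ?_⟩
    · simpa using h.swap_bases.neg.swap_first.swap_second
    · ext x; simp only [Finset.mem_insert, Finset.mem_singleton]; tauto

/-- Signs of the basic bilinear expressions in the vertices of a normalised frame. -/
theorem IsFrame.signs {A B C D : ℤ × ℤ} {u v k l s : ℤ} (hc : IsCoprime u v) (hl : 1 ≤ l)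
    (hlk : l < k) (hs : 1 ≤ s) (h : IsFrame A B C D u v k l s) :
    (B.1 - A.1) * (D.2 - C.2) - (B.2 - A.2) * (D.1 - C.1) = 0 ∧
    0 < (B.1 - A.1) * (D.1 - C.1) + (B.2 - A.2) * (D.2 - C.2) ∧
    (D.1 - C.1) ^ 2 + (D.2 - C.2) ^ 2 < (B.1 - A.1) ^ 2 + (B.2 - A.2) ^ 2 ∧
    0 < (B.1 - A.1) * (C.2 - A.2) - (B.2 - A.2) * (C.1 - A.1) ∧
    (A.1 - B.1) * (D.2 - B.2) - (A.2 - B.2) * (D.1 - B.1) < 0 ∧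
    0 < (C.1 - A.1) * (D.2 - B.2) - (C.2 - A.2) * (D.1 - B.1) ∧
    0 < (D.1 - A.1) * (C.2 - B.2) - (D.2 - A.2) * (C.1 - B.1) := by
  obtain ⟨h1, h2, h3, h4, h5, h6⟩ := h
  have hN : 0 < u ^ 2 + v ^ 2 := by
    obtain ⟨α, β, hab⟩ := hc
    by_contra hn
    have e1 : u = 0 := by nlinarith [sq_nonneg u, sq_nonneg v]
    have e2 : v = 0 := by nlinarith [sq_nonneg u, sq_nonneg v]
    simp [e1, e2] at hab
  have hk : 0 < k := by omega
  have p1 : 0 < k * l * (u ^ 2 + v ^ 2) := by positivity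
  have p2 : 0 < (k ^ 2 - l ^ 2) * (u ^ 2 + v ^ 2) := mul_pos (by nlinarith) hN
  have p3 : 0 < k * s * (u ^ 2 + v ^ 2) := by positivity
  have p4 : 0 < (k - l) * s * (u ^ 2 + v ^ 2) := mul_pos (mul_pos (by omega) (by omega)) hN
  have p5 : 0 < (k + l) * s * (u ^ 2 + v ^ 2) := by positivity
  have hB1 : B.1 = A.1 + k * u := by linarith
  have hB2 : B.2 = A.2 + k * v := by linarith
  have hD1 : D.1 = C.1 + l * u := by linarith
  have hD2 : D.2 = C.2 + l * v := by linarith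
  obtain ⟨x, hx⟩ : ∃ x, x = C.1 - A.1 := ⟨_, rfl⟩
  obtain ⟨y, hy⟩ : ∃ y, y = C.2 - A.2 := ⟨_, rfl⟩
  have hC1 : C.1 = A.1 + x := by linarith
  have hC2 : C.2 = A.2 + y := by linarith
  rw [← hx] at h5
  rw [← hy] at h6
  rw [hD1, hD2, hC1, hC2, hB1, hB2]
  have e : 2 * (u * y - v * x) = s * (u ^ 2 + v ^ 2) := by linear_combination u * h6 - v * h5
  refine ⟨by ring, by linarith only [p1], by linarith only [p2], ?_, ?_, ?_, ?_⟩
  · have : 2 * (k * (u * y - v * x)) = k * s * (u ^ 2 + v ^ 2) := by linear_combination k * e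
    linarith only [this, p3]
  · have : 2 * (k * (u * y - v * x)) = k * s * (u ^ 2 + v ^ 2) := by linear_combination k * e
    linarith only [this, p3]
  · have : 2 * ((k - l) * (u * y - v * x)) = (k - l) * s * (u ^ 2 + v ^ 2) := by
      linear_combination (k - l) * e
    linarith only [this, p4]
  · have : 2 * ((k + l) * (u * y - v * x)) = (k + l) * s * (u ^ 2 + v ^ 2) := by
      linear_combination (k + l) * e
    linarith only [this, p5]

-- Each non-identical matching of the vertices contradicts a sign in `IsFrame.signs`. Bases cannot
-- become legs or diagonals, as these pairs are not parallel when `l < k`; the bases cannot be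
-- exchanged, by length; one base cannot be reversed alone, by the inner product, nor both together,
-- by orientation.
set_option maxHeartbeats 1000000 in
open Classical in
theorem IsFrame.vertices_unique {A B C D A' B' C' D' : ℤ × ℤ} {u v k l s u' v' k' l' s' : ℤ}
    (hc : IsCoprime u v) (hl : 1 ≤ l) (hlk : l < k) (hs : 1 ≤ s) (h : IsFrame A B C D u v k l s)
    (hc' : IsCoprime u' v') (hl' : 1 ≤ l') (hlk' : l' < k') (hs' : 1 ≤ s')
    (h' : IsFrame A' B' C' D' u' v' k' l' s')
    (heq : ({A', B', C', D'} : Finset (ℤ × ℤ)) = {A, B, C, D}) :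
    A' = A ∧ B' = B ∧ C' = C ∧ D' = D := by
  obtain ⟨f1, f2, f3, f4, f5, f6, f7⟩ := h.signs hc hl hlk hs
  obtain ⟨g1, g2, g3, g4, g5, g6, g7⟩ := h'.signs hc' hl' hlk' hs'
  have hAB : A' ≠ B' := by rintro rfl; simp at g4
  have hAC : A' ≠ C' := by rintro rfl; simp at g4
  have hBC : B' ≠ C' := by rintro rfl; simp at g7
  have hAD : A' ≠ D' := by rintro rfl; simp at g7
  have hBD : B' ≠ D' := by rintro rfl; simp at g5
  have hCD : C' ≠ D' := by rintro rfl; simp at g2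
  have hA : A' ∈ ({A, B, C, D} : Finset (ℤ × ℤ)) := by simp [← heq]
  have hB : B' ∈ ({A, B, C, D} : Finset (ℤ × ℤ)) := by simp [← heq]
  have hC : C' ∈ ({A, B, C, D} : Finset (ℤ × ℤ)) := by simp [← heq]
  have hD : D' ∈ ({A, B, C, D} : Finset (ℤ × ℤ)) := by simp [← heq]
  clear h h' heq hc hc' hl hl' hlk hlk' hs hs'
  simp only [Finset.mem_insert, Finset.mem_singleton] at hA hB hC hD
  rcases hA with rfl | rfl | rfl | rfl <;> rcases hB with rfl | rfl | rfl | rfl <;>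
    first
    | exact absurd rfl hAB
    | (rcases hC with rfl | rfl | rfl | rfl <;>
        first
        | exact absurd rfl hAC
        | exact absurd rfl hBC
        | (rcases hD with rfl | rfl | rfl | rfl <;>
            first
            | exact absurd rfl hAD
            | exact absurd rfl hBD
            | exact absurd rfl hCD
            | exact ⟨rfl, rfl, rfl, rfl⟩
            | (exfalso; linarith only [g1, f6])
            | (exfalso; linarith only [g1, f7])
            | (exfalso; linarith only [g3, f3])
            | (exfalso; linarith only [g2, f2])
            | (exfalso; linarith only [g4, f5])))

theorem eq_of_mul_eq_mul_of_isCoprime {u v k u' v' k' : ℤ} (hc : IsCoprime u v)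
    (hc' : IsCoprime u' v') (hk : 0 < k) (hk' : 0 < k') (h1 : k * u = k' * u')
    (h2 : k * v = k' * v') : k = k' ∧ u = u' ∧ v = v' := by
  have e : k = k' := by
    have a1 : Int.gcd (k * u) (k * v) = k.natAbs := by
      rw [Int.gcd_mul_left, Int.isCoprime_iff_gcd_eq_one.1 hc, mul_one]
    have a2 : Int.gcd (k' * u') (k' * v') = k'.natAbs := by
      rw [Int.gcd_mul_left, Int.isCoprime_iff_gcd_eq_one.1 hc', mul_one]
    rw [h1, h2, a2] at a1
    omega
  subst e
  exact ⟨rfl, mul_left_cancel₀ hk.ne' h1, mul_left_cancel₀ hk.ne' h2⟩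

theorem IsFrame.params_unique {A B C D : ℤ × ℤ} {u v k l s u' v' k' l' s' : ℤ}
    (hc : IsCoprime u v) (hk : 0 < k) (h : IsFrame A B C D u v k l s)
    (hc' : IsCoprime u' v') (hk' : 0 < k') (h' : IsFrame A B C D u' v' k' l' s') :
    u = u' ∧ v = v' ∧ k = k' ∧ l = l' ∧ s = s' := by
  obtain ⟨h1, h2, h3, h4, h5, h6⟩ := h
  obtain ⟨g1, g2, g3, g4, g5, g6⟩ := h'
  obtain ⟨rfl, rfl, rfl⟩ := eq_of_mul_eq_mul_of_isCoprime hc hc' hk hk' (by linarith) (by linarith)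
  have hcancel : ∀ x y : ℤ, x * u = y * u → x * v = y * v → x = y := by
    intro x y e1 e2
    obtain ⟨α, β, hab⟩ := hc
    linear_combination (-(x - y)) * hab + α * e1 + β * e2
  have hl : l = l' := hcancel _ _ (by linarith) (by linarith)
  subst hl
  exact ⟨rfl, rfl, rfl, rfl, hcancel _ _ (by linarith) (by linarith)⟩

/-! ### Positions of a fixed shape in the grid -/

/-- The product of the positive parts of `n - W` and `n - H`, where `W` and `H` are the sides of the
bounding box of an isosceles trapezium in direction `(a, b)`. -/
noncomputable def boxWeight (n a b x y z : ℝ) : ℝ :=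
  max (n - (x * a + y * a + max (y * a) (z * b))) 0 *
    max (n - (x * b + y * b + max (y * b) (z * a))) 0

/-- One coordinate of the four vertices is `x`, `x + p + q`, `x + c`, `x + c + p`. The admissible
`x` form an interval, shorter than `[1, n]` by the spread of the offsets. As `p` and `q` have the
same sign, this spread is given by the half-integral expression on the right. -/
theorem card_filter_translates {n p q r c : ℤ} (hpq : 0 ≤ p ∧ 0 ≤ q ∨ p ≤ 0 ∧ q ≤ 0)
    (hc : 2 * c = q - r) :
    ((((Finset.Icc 1 n).filter fun x => x + (p + q) ∈ Finset.Icc 1 n ∧ x + c ∈ Finset.Icc 1 n ∧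
      x + c + p ∈ Finset.Icc 1 n).card : ℕ) : ℝ) =
      max ((n : ℝ) - (|(p : ℝ)| + |(q : ℝ)| / 2 + max (|(q : ℝ)| / 2) (|(r : ℝ)| / 2))) 0 := by
  have hset : ((Finset.Icc 1 n).filter fun x => x + (p + q) ∈ Finset.Icc 1 n ∧
      x + c ∈ Finset.Icc 1 n ∧ x + c + p ∈ Finset.Icc 1 n) =
      Finset.Icc (1 - min (min 0 (p + q)) (min c (c + p)))
        (n - max (max 0 (p + q)) (max c (c + p))) := by
    ext x
    simp only [Finset.mem_filter, Finset.mem_Icc]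
    omega
  rw [hset, Int.card_Icc]
  have hint : 2 * (max (max 0 (p + q)) (max c (c + p)) - min (min 0 (p + q)) (min c (c + p))) =
      2 * |p| + |q| + max |q| |r| := by
    rcases hpq with ⟨hp, hq⟩ | ⟨hp, hq⟩
    · rw [abs_of_nonneg hp, abs_of_nonneg hq]
      rcases abs_cases r with ⟨h, _⟩ | ⟨h, _⟩ <;> rw [h] <;> omega
    · rw [abs_of_nonpos hp, abs_of_nonpos hq]
      rcases abs_cases r with ⟨h, _⟩ | ⟨h, _⟩ <;> rw [h] <;> omega
  have hreal : |(p : ℝ)| + |(q : ℝ)| / 2 + max (|(q : ℝ)| / 2) (|(r : ℝ)| / 2) =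
      ((max (max 0 (p + q)) (max c (c + p)) - min (min 0 (p + q)) (min c (c + p)) : ℤ) : ℝ) := by
    have h2 : (((2 * (max (max 0 (p + q)) (max c (c + p)) - min (min 0 (p + q)) (min c (c + p)))
      : ℤ)) : ℝ) = ((2 * |p| + |q| + max |q| |r| : ℤ) : ℝ) := by rw [hint]
    rw [Int.cast_mul] at h2
    rw [max_div_div_right (by norm_num : (0 : ℝ) ≤ 2)]
    push_cast at h2 ⊢
    linarith
  rw [hreal]
  have : ∀ z : ℤ, ((z.toNat : ℕ) : ℝ) = max (z : ℝ) 0 := by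
    intro z
    rw [← Int.cast_natCast, Int.toNat_eq_max]
    push_cast
    rfl
  rw [this]
  congr 1
  push_cast
  ring

/-- The second end of the base of length `k |(u, v)|` at `A`. -/
def baseEnd (u v k : ℤ) (A : ℤ × ℤ) : ℤ × ℤ := (A.1 + k * u, A.2 + k * v)

/-- The first end of the opposite base. -/
def legEnd (u v d s : ℤ) (A : ℤ × ℤ) : ℤ × ℤ :=
  (A.1 + (d * u - s * v) / 2, A.2 + (d * v + s * u) / 2)

theorem isFrame_baseEnd {u v l d s : ℤ} (h1 : 2 ∣ d * u - s * v) (h2 : 2 ∣ d * v + s * u)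
    (A : ℤ × ℤ) :
    IsFrame A (baseEnd u v (l + d) A) (legEnd u v d s A) (baseEnd u v l (legEnd u v d s A))
      u v (l + d) l s := by
  refine ⟨?_, ?_, ?_, ?_, ?_, ?_⟩ <;> simp only [baseEnd, legEnd]
  · ring
  · ring
  · ring
  · ring
  · rw [add_sub_cancel_left, Int.mul_ediv_cancel' h1]; ring
  · rw [add_sub_cancel_left, Int.mul_ediv_cancel' h2]; ring

theorem IsFrame.eq_baseEnd {A B C D : ℤ × ℤ} {u v k l s : ℤ} (h : IsFrame A B C D u v k l s) :
    B = baseEnd u v k A ∧ C = legEnd u v (k - l) s A ∧ D = baseEnd u v l C ∧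
      2 ∣ (k - l) * u - s * v ∧ 2 ∣ (k - l) * v + s * u := by
  obtain ⟨h1, h2, h3, h4, h5, h6⟩ := h
  refine ⟨Prod.ext ?_ ?_, Prod.ext ?_ ?_, Prod.ext ?_ ?_, ⟨_, h5.symm⟩, ⟨_, h6.symm⟩⟩ <;>
    simp only [baseEnd, legEnd]
  · linarith
  · linarith
  · rw [← h5]; omega
  · rw [← h6]; omega
  · linarith
  · linarith

/-- The positions of a trapezium of given shape in the grid. -/
noncomputable def positions (n : ℕ) (u v l d s : ℤ) : Finset (ℤ × ℤ) :=
  (grid n).filter fun A => baseEnd u v (l + d) A ∈ grid n ∧ legEnd u v d s A ∈ grid n ∧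
    baseEnd u v l (legEnd u v d s A) ∈ grid n

theorem card_positions (n : ℕ) {u v l d s : ℤ} (hl : 0 ≤ l) (hd : 0 ≤ d) (hs : 0 ≤ s)
    (h1 : 2 ∣ d * u - s * v) (h2 : 2 ∣ d * v + s * u) :
    ((positions n u v l d s).card : ℝ) =
      boxWeight n (u.natAbs : ℕ) (v.natAbs : ℕ) l (d / 2) (s / 2) := by
  have hprod : positions n u v l d s =
      ((Finset.Icc 1 (n : ℤ)).filter fun x => x + (l * u + d * u) ∈ Finset.Icc 1 (n : ℤ) ∧
        x + (d * u - s * v) / 2 ∈ Finset.Icc 1 (n : ℤ) ∧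
        x + (d * u - s * v) / 2 + l * u ∈ Finset.Icc 1 (n : ℤ)) ×ˢ
      ((Finset.Icc 1 (n : ℤ)).filter fun x => x + (l * v + d * v) ∈ Finset.Icc 1 (n : ℤ) ∧
        x + (d * v + s * u) / 2 ∈ Finset.Icc 1 (n : ℤ) ∧
        x + (d * v + s * u) / 2 + l * v ∈ Finset.Icc 1 (n : ℤ)) := by
    ext ⟨x, y⟩
    simp only [positions, grid, baseEnd, legEnd, Finset.mem_filter, Finset.mem_product, add_mul]
    tauto
  have hsign : ∀ w : ℤ, 0 ≤ l * w ∧ 0 ≤ d * w ∨ l * w ≤ 0 ∧ d * w ≤ 0 := by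
    intro w
    rcases le_total 0 w with hw | hw
    · exact Or.inl ⟨mul_nonneg hl hw, mul_nonneg hd hw⟩
    · exact Or.inr ⟨mul_nonpos_of_nonneg_of_nonpos hl hw, mul_nonpos_of_nonneg_of_nonpos hd hw⟩
  rw [hprod, Finset.card_product, Nat.cast_mul,
    card_filter_translates (r := s * v) (hsign u) (Int.mul_ediv_cancel' h1),
    card_filter_translates (r := -(s * u)) (hsign v)
      (by rw [Int.mul_ediv_cancel' h2]; ring)]
  have hl' : (0 : ℝ) ≤ l := by exact_mod_cast hl
  have hd' : (0 : ℝ) ≤ d := by exact_mod_cast hd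
  have hs' : (0 : ℝ) ≤ s := by exact_mod_cast hs
  simp only [boxWeight, Nat.cast_natAbs, Int.cast_abs, Int.cast_neg, abs_neg, Int.cast_mul,
    abs_mul, abs_of_nonneg hl', abs_of_nonneg hd', abs_of_nonneg hs', Int.cast_natCast]
  congr 2 <;> · congr 2 <;> ring_nf

/-! ### Summation over shapes: upper and lower bounds -/

/-- The offset of the even (`false`) or the odd (`true`) residue class. -/
def parityShift (e : ℕ) (t : Bool) : ℕ := bif t then 1 else e

/-- Indices `((u, v), t, l, j, m)` of the shapes of isosceles trapezia. -/
noncomputable def shapeIndex (n : ℕ) : Finset ((ℤ × ℤ) × Bool × ℕ × ℕ × ℕ) :=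
  ((Finset.Icc (-(n : ℤ)) n ×ˢ Finset.Icc (-(n : ℤ)) n) ×ˢ
    (Finset.univ ×ˢ Finset.range n ×ˢ Finset.range n ×ˢ Finset.range n)).filter
      fun i => Int.gcd i.1.1 i.1.2 = 1 ∧ (i.2.1 = true → Even (i.1.1.natAbs + i.1.2.natAbs))

theorem mem_shapeIndex {n : ℕ} {u v : ℤ} {t : Bool} {l j m : ℕ} :
    ((u, v), t, l, j, m) ∈ shapeIndex n ↔
      (u ∈ Finset.Icc (-(n : ℤ)) n ∧ v ∈ Finset.Icc (-(n : ℤ)) n) ∧ (l < n ∧ j < n ∧ m < n) ∧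
        Int.gcd u v = 1 ∧ (t = true → Even (u.natAbs + v.natAbs)) := by
  simp only [shapeIndex, Finset.mem_filter, Finset.mem_product, Finset.mem_univ, Finset.mem_range]
  tauto

/-- The positions of the trapezia with the shape of index `i`. -/
noncomputable def shapePositions (e n : ℕ) (i : (ℤ × ℤ) × Bool × ℕ × ℕ × ℕ) : Finset (ℤ × ℤ) :=
  positions n i.1.1 i.1.2 (i.2.2.1 + 1 : ℕ) (2 * i.2.2.2.1 + parityShift e i.2.1 : ℕ)
    (2 * i.2.2.2.2 + parityShift 2 i.2.1 : ℕ)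

open Classical in
/-- The vertices of a trapezium in terms of its shape and its position. -/
noncomputable def shapeVertices (e : ℕ) (i : (ℤ × ℤ) × Bool × ℕ × ℕ × ℕ) (A : ℤ × ℤ) :
    Finset (ℤ × ℤ) :=
  {A, baseEnd i.1.1 i.1.2 ((i.2.2.1 + 1 : ℕ) + (2 * i.2.2.2.1 + parityShift e i.2.1 : ℕ)) A,
    legEnd i.1.1 i.1.2 (2 * i.2.2.2.1 + parityShift e i.2.1 : ℕ)
      (2 * i.2.2.2.2 + parityShift 2 i.2.1 : ℕ) A,
    baseEnd i.1.1 i.1.2 (i.2.2.1 + 1 : ℕ)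
      (legEnd i.1.1 i.1.2 (2 * i.2.2.2.1 + parityShift e i.2.1 : ℕ)
      (2 * i.2.2.2.2 + parityShift 2 i.2.1 : ℕ) A)}

theorem two_dvd_of_parityShift {e : ℕ} (he : Even e) {u v : ℤ} {t : Bool} (j m : ℕ)
    (ht : t = true → Even (u.natAbs + v.natAbs)) :
    2 ∣ ((2 * j + parityShift e t : ℕ) : ℤ) * u - ((2 * m + parityShift 2 t : ℕ) : ℤ) * v ∧
    2 ∣ ((2 * j + parityShift e t : ℕ) : ℤ) * v + ((2 * m + parityShift 2 t : ℕ) : ℤ) * u := by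
  cases t with
  | false =>
    obtain ⟨r, rfl⟩ := he
    simp only [parityShift, cond_false]
    push_cast
    exact ⟨⟨(j + r) * u - (m + 1) * v, by ring⟩, ⟨(j + r) * v + (m + 1) * u, by ring⟩⟩
  | true =>
    have h : Even (u + v) := by
      have := ht rfl
      rw [Int.even_add, ← Int.natAbs_even, ← Int.natAbs_even]
      exact Nat.even_add.1 this
    obtain ⟨r, hr⟩ := h
    have hv : v = 2 * r - u := by omega
    subst hv
    simp only [parityShift, cond_true]
    push_cast
    exact ⟨⟨j * u - m * (2 * r - u) + u - r, by ring⟩, ⟨j * (2 * r - u) + m * u + r, by ring⟩⟩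

/-- Modulo 2 the conditions read `d u = s v` and `d v = s u`. If only one of `u`, `v` is odd, they
force `d` and `s` to be even; if both are odd, they say `d = s`. Coprimality excludes the remaining
case. -/
theorem parity_of_two_dvd {u v d s : ℤ} (hc : Int.gcd u v = 1) (h1 : 2 ∣ d * u - s * v)
    (h2 : 2 ∣ d * v + s * u) :
    (Even d ∧ Even s) ∨ (¬ Even d ∧ ¬ Even s ∧ Even (u.natAbs + v.natAbs)) := by
  have h1' : Even (d * u - s * v) := even_iff_two_dvd.2 h1
  have h2' : Even (d * v + s * u) := even_iff_two_dvd.2 h2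
  have h3 : ¬ (Even u ∧ Even v) := by
    rintro ⟨hu, hv⟩
    have := Int.dvd_coe_gcd (even_iff_two_dvd.1 hu) (even_iff_two_dvd.1 hv)
    rw [hc] at this
    omega
  rw [Int.even_sub, Int.even_mul, Int.even_mul] at h1'
  rw [Int.even_add, Int.even_mul, Int.even_mul] at h2'
  rw [Nat.even_add, Int.natAbs_even, Int.natAbs_even]
  tauto

theorem abs_le_of_mem_grid {n : ℕ} {A B : ℤ × ℤ} (hA : A ∈ grid n) (hB : B ∈ grid n) :
    |B.1 - A.1| < n ∧ |B.2 - A.2| < n := by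
  simp only [grid, Finset.mem_product, Finset.mem_Icc] at hA hB
  constructor <;> rw [abs_lt] <;> constructor <;> omega

theorem lt_of_mul_abs_lt {n u v k : ℤ} (hc : IsCoprime u v) (hk : 0 ≤ k) (h1 : |k * u| < n)
    (h2 : |k * v| < n) : k < n := by
  have hne : u ≠ 0 ∨ v ≠ 0 := by
    by_contra! h
    obtain ⟨rfl, rfl⟩ := h
    obtain ⟨x, y, hxy⟩ := hc
    simp at hxy
  rw [abs_mul, abs_of_nonneg hk] at h1 h2
  rcases hne with h | h
  · have := Int.one_le_abs h
    nlinarith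
  · have := Int.one_le_abs h
    nlinarith

theorem abs_lt_of_mul_abs_lt {n u k : ℤ} (hk : 1 ≤ k) (h1 : |k * u| < n) : |u| < n := by
  rw [abs_mul, abs_of_nonneg (by omega : 0 ≤ k)] at h1
  nlinarith [abs_nonneg u]

/-- Offset `0` lets `d = k - l` vanish, so every trapezium, rectangles included, arises from some
index and position. A rectangle may arise several times, which does no harm to an upper bound. -/
theorem numIsoscelesTrapezia_le_sum (n : ℕ) :
    numIsoscelesTrapezia n ≤ ∑ i ∈ shapeIndex n, (shapePositions 0 n i).card := by
  classical
  rw [← Finset.card_sigma]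
  refine le_trans (Finset.card_le_card ?_)
    (Finset.card_image_le (f := fun x => shapeVertices 0 x.1 x.2))
  intro T hT
  rw [Finset.mem_filter, Finset.mem_powersetCard] at hT
  obtain ⟨⟨hTn, -⟩, A₀, B₀, C₀, D₀, rfl, htrap⟩ := hT
  obtain ⟨e1, e2, e3, e4, e5⟩ := htrap.equations
  obtain ⟨u₀, v₀, k₀, l₀, s₀, hc₀, hk₀, hl₀, hs₀, hf₀⟩ := exists_isFrame e1 e2 e3 e4 e5
  obtain ⟨A, B, C, D, u, v, k, l, s, hc, hl, hlk, hs, hf, hset⟩ :=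
    hf₀.normalize hc₀ hk₀ hl₀ hs₀
  obtain ⟨rfl, hC, hD, hd1, hd2⟩ := hf.eq_baseEnd
  have hcg := Int.isCoprime_iff_gcd_eq_one.1 hc
  have hsub : ({A, baseEnd u v k A, C, D} : Finset (ℤ × ℤ)) ⊆ grid n := by
    rw [hset]
    convert hTn
  have hA : A ∈ grid n := hsub (by simp)
  have hB : baseEnd u v k A ∈ grid n := hsub (by simp)
  have hCn : C ∈ grid n := hsub (by simp)
  have hDn : D ∈ grid n := hsub (by simp)
  obtain ⟨b1, b2⟩ := abs_le_of_mem_grid hA hB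
  obtain ⟨c1, c2⟩ := abs_le_of_mem_grid hA hCn
  obtain ⟨c3, c4⟩ := abs_le_of_mem_grid hB hDn
  obtain ⟨f1, f2, f3, f4, f5, f6⟩ := hf
  rw [f1] at b1
  rw [f2] at b2
  have hkn : k < n := lt_of_mul_abs_lt hc (by omega) b1 b2
  have hun := abs_lt_of_mul_abs_lt (by omega : 1 ≤ k) b1
  have hvn := abs_lt_of_mul_abs_lt (by omega : 1 ≤ k) b2
  rw [abs_lt] at hun hvn c1 c2 c3 c4
  -- The displacements from `A` to `C` and from `B` to `D` add up to `s (-v, u)`, and each has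
  -- coordinates below `n` in absolute value.
  have hsn : s < 2 * n := by
    refine lt_of_mul_abs_lt hc (by omega) ?_ ?_
    · rw [abs_lt]; constructor <;> linarith
    · rw [abs_lt]; constructor <;> linarith
  obtain ⟨t, j, m, hj, hm, hjn, hmn, ht⟩ : ∃ (t : Bool) (j m : ℕ),
      ((2 * j + parityShift 0 t : ℕ) : ℤ) = k - l ∧ ((2 * m + parityShift 2 t : ℕ) : ℤ) = s ∧
        j < n ∧ m < n ∧ (t = true → Even (u.natAbs + v.natAbs)) := by
    rcases parity_of_two_dvd hcg hd1 hd2 with ⟨hde, hse⟩ | ⟨hde, hse, huv⟩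
    · rw [Int.even_iff] at hde hse
      refine ⟨false, ((k - l) / 2).toNat, (s / 2 - 1).toNat, ?_, ?_, ?_, ?_, by simp⟩ <;>
        (try simp only [parityShift, cond_false]) <;> omega
    · rw [Int.even_iff] at hde hse
      refine ⟨true, ((k - l) / 2).toNat, (s / 2).toNat, ?_, ?_, ?_, ?_, fun _ => huv⟩ <;>
        (try simp only [parityShift, cond_true]) <;> omega
  have hl' : (((l - 1).toNat + 1 : ℕ) : ℤ) = l := by omega
  rw [Finset.mem_image]
  refine ⟨⟨((u, v), t, (l - 1).toNat, j, m), A⟩, ?_, ?_⟩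
  · rw [Finset.mem_sigma, mem_shapeIndex]
    refine ⟨⟨?_, ⟨by omega, hjn, hmn⟩, hcg, ht⟩, ?_⟩
    · rw [Finset.mem_Icc, Finset.mem_Icc]; omega
    · simp only [shapePositions, positions, Finset.mem_filter]
      rw [hj, hm, hl', add_sub_cancel, ← hC, ← hD]
      exact ⟨hA, hB, hCn, hDn⟩
  · simp only [shapeVertices]
    rw [hj, hm, hl', add_sub_cancel, ← hC, ← hD, hset]

/-- Offset `2` makes `d` positive in both parity classes, so only non-rectangles arise, and by
uniqueness of the normalised frame each arises once. -/
theorem sum_le_numIsoscelesTrapezia (n : ℕ) :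
    ∑ i ∈ shapeIndex n, (shapePositions 2 n i).card ≤ numIsoscelesTrapezia n := by
  classical
  rw [← Finset.card_sigma]
  have hframe : ∀ x ∈ (shapeIndex n).sigma (shapePositions 2 n),
      ∃ (u v : ℤ) (t : Bool) (l j m : ℕ) (A B C D : ℤ × ℤ), x = ⟨((u, v), t, l, j, m), A⟩ ∧
        IsCoprime u v ∧ shapeVertices 2 x.1 x.2 = {A, B, C, D} ∧
        IsFrame A B C D u v ((l + 1 : ℕ) + (2 * j + parityShift 2 t : ℕ)) (l + 1 : ℕ)
          (2 * m + parityShift 2 t : ℕ) ∧ {A, B, C, D} ⊆ grid n ∧ 1 ≤ parityShift 2 t := by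
    rintro ⟨⟨⟨u, v⟩, t, l, j, m⟩, A⟩ hx
    rw [Finset.mem_sigma, mem_shapeIndex] at hx
    obtain ⟨⟨-, -, hcg, ht⟩, hpos⟩ := hx
    obtain ⟨h1, h2⟩ := two_dvd_of_parityShift (e := 2) even_two j m ht
    simp only [shapePositions, positions, Finset.mem_filter] at hpos
    refine ⟨u, v, t, l, j, m, A, _, _, _, rfl, Int.isCoprime_iff_gcd_eq_one.2 hcg, ?_,
      isFrame_baseEnd h1 h2 A, ?_, ?_⟩
    · simp only [shapeVertices]
    · intro P hP
      simp only [Finset.mem_insert, Finset.mem_singleton] at hP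
      rcases hP with rfl | rfl | rfl | rfl
      exacts [hpos.1, hpos.2.1, hpos.2.2.1, hpos.2.2.2]
    · cases t <;> simp [parityShift]
  have hcard : ∀ {A B C D : ℤ × ℤ} {u v k l s : ℤ}, IsCoprime u v → 1 ≤ l → l < k → 1 ≤ s →
      IsFrame A B C D u v k l s → ({A, B, C, D} : Finset (ℤ × ℤ)).card = 4 := by
    intro A B C D u v k l s hc hl hlk hs h
    obtain ⟨g1, g2, g3, g4, g5, g6, g7⟩ := h.signs hc hl hlk hs
    have hAB : A ≠ B := by rintro rfl; simp at g4
    have hAC : A ≠ C := by rintro rfl; simp at g4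
    have hBC : B ≠ C := by rintro rfl; simp at g7
    have hAD : A ≠ D := by rintro rfl; simp at g7
    have hBD : B ≠ D := by rintro rfl; simp at g5
    have hCD : C ≠ D := by rintro rfl; simp at g2
    rw [Finset.card_insert_of_notMem (by simp [hAB, hAC, hAD]),
      Finset.card_insert_of_notMem (by simp [hBC, hBD]), Finset.card_pair hCD]
  refine Finset.card_le_card_of_injOn (fun x => shapeVertices 2 x.1 x.2) ?_ ?_
  · intro x hx
    obtain ⟨u, v, t, l, j, m, A, B, C, D, rfl, hc, hv, hf, hsub, hp⟩ := hframe x hx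
    have hk := hcard hc (by omega) (by omega) (by omega) hf
    rw [Finset.mem_coe, Finset.mem_filter, Finset.mem_powersetCard]
    beta_reduce
    rw [hv]
    refine ⟨⟨hsub, hk⟩, A, B, C, D, rfl, ?_⟩
    obtain ⟨-, -, -, g4, -⟩ := hf.signs hc (by omega) (by omega) (by omega)
    obtain ⟨h1, h2, h3, h4, h5, h6⟩ := hf
    refine isIsoscelesTrapezium_of_equations (by omega) (by omega) h1 h2 h3 h4 ?_ ?_
    · linear_combination u * h5 + v * h6 + u * h3 + v * h4 - u * h1 - v * h2
    · intro h0
      rw [h1, h2] at g4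
      apply g4.ne'
      linear_combination ((l + 1 : ℕ) + (2 * j + parityShift 2 t : ℕ) : ℤ) * h0
  · intro x hx y hy hxy
    obtain ⟨u, v, t, l, j, m, A, B, C, D, rfl, hc, hv, hf, hsub, hp⟩ := hframe x hx
    obtain ⟨u', v', t', l', j', m', A', B', C', D', rfl, hc', hv', hf', hsub', hp'⟩ := hframe y hy
    have hxy' : ({A', B', C', D'} : Finset (ℤ × ℤ)) = {A, B, C, D} := by
      rw [← hv, ← hv']; exact hxy.symm
    obtain ⟨rfl, rfl, rfl, rfl⟩ := hf.vertices_unique hc (by omega) (by omega) (by omega)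
      hc' (by omega) (by omega) (by omega) hf' (by convert hxy')
    obtain ⟨rfl, rfl, hk, hl, hs⟩ := hf.params_unique hc (by omega) hc' (by omega) hf'
    have htt : t = t' := by
      cases t <;> cases t' <;> simp only [parityShift, cond_false, cond_true] at hs <;>
        first | rfl | omega
    subst htt
    obtain rfl : l = l' := by omega
    obtain rfl : j = j' := by omega
    obtain rfl : m = m' := by omega
    rfl

/-- The number of trapezia with direction `(a, b)`, up to rectangles. -/
noncomputable def shapeSum (e n a b : ℕ) : ℝ :=
  ∑ t : Bool, if t = true → Even (a + b) then
    ∑ l ∈ Finset.range n, ∑ j ∈ Finset.range n, ∑ m ∈ Finset.range n,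
      boxWeight n a b (l + 1) (j + (parityShift e t : ℝ) / 2) (m + (parityShift 2 t : ℝ) / 2)
  else 0

theorem sum_card_shapePositions {e : ℕ} (he : Even e) (n : ℕ) :
    ((∑ i ∈ shapeIndex n, (shapePositions e n i).card : ℕ) : ℝ) =
      ∑ u ∈ Finset.Icc (-(n : ℤ)) n, ∑ v ∈ Finset.Icc (-(n : ℤ)) n,
        if Nat.gcd u.natAbs v.natAbs = 1 then shapeSum e n u.natAbs v.natAbs else 0 := by
  rw [shapeIndex, Finset.sum_filter, Finset.sum_product, Finset.sum_product, Nat.cast_sum]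
  refine Finset.sum_congr rfl fun u _ => ?_
  rw [Nat.cast_sum]
  refine Finset.sum_congr rfl fun v _ => ?_
  split_ifs with hg
  · have hg' : Int.gcd u v = 1 := hg
    rw [Finset.sum_product, shapeSum, Nat.cast_sum]
    refine Finset.sum_congr rfl fun t _ => ?_
    simp only [hg', true_and]
    by_cases ht : t = true → Even (u.natAbs + v.natAbs)
    · simp only [if_pos ht]
      rw [Finset.sum_product, Nat.cast_sum]
      refine Finset.sum_congr rfl fun l _ => ?_
      rw [Finset.sum_product, Nat.cast_sum]
      refine Finset.sum_congr rfl fun j _ => ?_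
      rw [Nat.cast_sum]
      refine Finset.sum_congr rfl fun m _ => ?_
      obtain ⟨h1, h2⟩ := two_dvd_of_parityShift he j m ht
      rw [shapePositions, card_positions n (by positivity) (by positivity) (by positivity) h1 h2]
      congr 1 <;> push_cast <;> ring
    · simp only [if_neg ht, Finset.sum_const_zero, Nat.cast_zero]
  · have hg' : ¬ Int.gcd u v = 1 := hg
    simp only [hg', false_and, if_false, Finset.sum_const_zero, Nat.cast_zero]

/-! ### Integrals over simplicial cones -/

open MeasureTheory Set in
theorem ofReal_mul_lintegral_Ioi_comp_mul {β : ℝ} (hβ : 0 < β) (f : ℝ → ENNReal) :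
    ENNReal.ofReal β * ∫⁻ t in Ioi 0, f (β * t) = ∫⁻ t in Ioi 0, f t := by
  have hemb := measurableEmbedding_mulLeft₀ hβ.ne'
  conv_rhs => rw [← Real.smul_map_volume_mul_left hβ.ne']
  rw [Measure.restrict_smul, lintegral_smul_measure, hemb.restrict_map, hemb.lintegral_map,
    abs_of_pos hβ, smul_eq_mul]
  congr 3
  ext x
  simp [hβ]

open MeasureTheory Set in
theorem lintegral_Ioi_comp_add (c : ℝ) (f : ℝ → ENNReal) :
    ∫⁻ t in Ioi 0, f (t + c) = ∫⁻ t in Ioi c, f t := by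
  have h := (measurePreserving_add_right (volume : Measure ℝ) c).setLIntegral_comp_preimage_emb
    (MeasurableEquiv.addRight c).measurableEmbedding f (Ioi c)
  rw [← h]
  congr 2
  ext x; simp

-- The result is again a power of a positive part times a factor linear in the data, so the formula
-- can be iterated over three variables. The hypothesis `hpos` bounds the linear factor below by `0`
-- at both ends of the support, hence on all of it.
open MeasureTheory Set in
theorem lintegral_Ioi_max_pow_mul (m : ℕ) {A B w h : ℝ} (hw : 0 < w)
    (hpos : 0 ≤ A → 0 ≤ B ∧ 0 ≤ B - h * (A / w)) :
    ∫⁻ t in Ioi 0, ENNReal.ofReal (max (A - w * t) 0 ^ (m + 1) * (B - h * t)) =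
      ENNReal.ofReal (max A 0 ^ (m + 2) / ((m + 2) * w) * (B - h * A / ((m + 3) * w))) := by
  have hzero : ∀ t ∈ Ioi (0 : ℝ), A / w < t →
      ENNReal.ofReal (max (A - w * t) 0 ^ (m + 1) * (B - h * t)) = 0 := by
    intro t _ ht
    rw [div_lt_iff₀ hw] at ht
    rw [max_eq_right (by linarith), zero_pow (by omega), zero_mul, ENNReal.ofReal_zero]
  rcases le_or_gt A 0 with hA | hA
  · rw [max_eq_right hA, zero_pow (by omega), zero_div, zero_mul, ENNReal.ofReal_zero]
    rw [setLIntegral_congr_fun measurableSet_Ioi (g := fun _ => 0), lintegral_zero]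
    intro t ht
    exact hzero t ht (lt_of_le_of_lt (div_nonpos_of_nonpos_of_nonneg hA hw.le) ht)
  · have hc : 0 ≤ A / w := by positivity
    obtain ⟨hB, hB'⟩ := hpos hA.le
    have hsplit : Ioi (0 : ℝ) = Ioc 0 (A / w) ∪ Ioi (A / w) := (Ioc_union_Ioi_eq_Ioi hc).symm
    rw [hsplit, lintegral_union measurableSet_Ioi (Ioc_disjoint_Ioi le_rfl),
      setLIntegral_congr_fun (g := fun _ => 0) (s := Ioi (A / w)) measurableSet_Ioi
        (fun t ht => hzero t (lt_of_le_of_lt hc ht) ht), lintegral_zero, add_zero,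
      setLIntegral_congr_fun (g := fun t => ENNReal.ofReal ((A - w * t) ^ (m + 1) * (B - h * t)))
        measurableSet_Ioc]
    · rw [← ofReal_integral_eq_lintegral_ofReal, ← intervalIntegral.integral_of_le hc,
        intervalIntegral.integral_eq_sub_of_hasDerivAt (f := fun t =>
          -((A - w * t) ^ (m + 2) * (B - h * t)) / ((m + 2) * w) +
            h * (A - w * t) ^ (m + 3) / ((m + 2) * (m + 3) * w ^ 2))]
      · congr 1
        have : A - w * (A / w) = 0 := by field_simp; ring
        rw [this, max_eq_left hA.le]
        simp
        field_simp
        ring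
      · intro t _
        have h1 : HasDerivAt (fun t => A - w * t) (-w) t := by
          simpa using ((hasDerivAt_id t).const_mul w).const_sub A
        have h2 : HasDerivAt (fun t => B - h * t) (-h) t := by
          simpa using ((hasDerivAt_id t).const_mul h).const_sub B
        have h3 : HasDerivAt (fun t => -((A - w * t) ^ (m + 2) * (B - h * t)) / ((m + 2) * w) +
            h * (A - w * t) ^ (m + 3) / ((m + 2) * (m + 3) * w ^ 2))
            (-(((m + 2 : ℕ) : ℝ) * (A - w * t) ^ (m + 1) * -w * (B - h * t) +
              (A - w * t) ^ (m + 2) * -h) / ((m + 2) * w) +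
              h * (((m + 3 : ℕ) : ℝ) * (A - w * t) ^ (m + 2) * -w) /
                ((m + 2) * (m + 3) * w ^ 2)) t :=
          (((h1.pow (m + 2)).mul h2).neg.div_const ((m + 2) * w)).add
            (((h1.pow (m + 3)).const_mul h).div_const ((m + 2) * (m + 3) * w ^ 2))
        refine h3.congr_deriv ?_
        push_cast
        field_simp
        ring
      · exact (by fun_prop : Continuous _).intervalIntegrable _ _
      · exact (by fun_prop : Continuous _).integrableOn_Ioc
      · refine (ae_restrict_iff' measurableSet_Ioc).2 (Eventually.of_forall fun t ht => ?_)
        have ht2 := ht.2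
        rw [le_div_iff₀ hw] at ht2
        refine mul_nonneg (pow_nonneg (by linarith) _) ?_
        rcases le_total 0 h with h0 | h0
        · have := mul_le_mul_of_nonneg_left ht.2 h0
          linarith
        · have := mul_nonpos_of_nonpos_of_nonneg h0 ht.1.le
          linarith
    · intro t ht
      have ht2 := ht.2
      rw [le_div_iff₀ hw] at ht2
      simp only
      rw [max_eq_left (by linarith)]

open MeasureTheory Set in
theorem lintegral_quadrant_eq_add {g : ℝ → ℝ → ENNReal} (hg : Measurable (Function.uncurry g))
    {c : ℝ} (hc : 0 < c) :
    ∫⁻ x in Ioi 0, ∫⁻ y in Ioi 0, g x y =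
      (∫⁻ y in Ioi 0, ∫⁻ x in Ioi (c * y), g x y) +
        ∫⁻ x in Ioi 0, ∫⁻ y in Ioi (c⁻¹ * x), g x y := by
  have hswap : ∫⁻ x in Ioi 0, ∫⁻ y in Ioi (c⁻¹ * x), g x y =
      ∫⁻ y in Ioi 0, ∫⁻ x in Ioo 0 (c * y), g x y := by
    have h1 : ∀ x ∈ Ioi (0 : ℝ), ∫⁻ y in Ioi (c⁻¹ * x), g x y =
        ∫⁻ y in Ioi 0, {p : ℝ × ℝ | c⁻¹ * p.1 < p.2}.indicator (Function.uncurry g) (x, y) := by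
      intro x hx
      have : ∀ y, {p : ℝ × ℝ | c⁻¹ * p.1 < p.2}.indicator (Function.uncurry g) (x, y) =
          (Ioi (c⁻¹ * x)).indicator (g x) y := fun y => by simp [indicator]
      simp only [this]
      rw [lintegral_indicator measurableSet_Ioi, Measure.restrict_restrict measurableSet_Ioi,
        inter_eq_left.2]
      exact Ioi_subset_Ioi (mul_nonneg (inv_nonneg.2 hc.le) (le_of_lt hx))
    have h2 : ∀ y ∈ Ioi (0 : ℝ), ∫⁻ x in Ioo 0 (c * y), g x y =
        ∫⁻ x in Ioi 0, {p : ℝ × ℝ | c⁻¹ * p.1 < p.2}.indicator (Function.uncurry g) (x, y) := by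
      intro y hy
      have : ∀ x, {p : ℝ × ℝ | c⁻¹ * p.1 < p.2}.indicator (Function.uncurry g) (x, y) =
          (Iio (c * y)).indicator (fun x => g x y) x := fun x => by
        simp [indicator, inv_mul_lt_iff₀ hc]
      simp only [this]
      rw [lintegral_indicator measurableSet_Iio, Measure.restrict_restrict measurableSet_Iio,
        inter_comm, Ioi_inter_Iio]
    rw [setLIntegral_congr_fun measurableSet_Ioi h1, setLIntegral_congr_fun measurableSet_Ioi h2]
    refine lintegral_lintegral_swap (Measurable.aemeasurable ?_)
    exact hg.indicator (measurableSet_lt (by fun_prop) (by fun_prop))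
  have hmeas : Measurable fun y => ∫⁻ x in Ioo 0 (c * y), g x y := by
    have : (fun y => ∫⁻ x in Ioo 0 (c * y), g x y) = fun y =>
        ∫⁻ x, {p : ℝ × ℝ | 0 < p.1 ∧ p.1 < c * p.2}.indicator (Function.uncurry g) (x, y) := by
      ext y
      rw [← lintegral_indicator measurableSet_Ioo]
      rfl
    rw [this]
    refine Measurable.lintegral_prod_left' (hg.indicator ?_)
    exact (measurableSet_lt measurable_const measurable_fst).inter
      (measurableSet_lt measurable_fst (measurable_snd.const_mul c))
  rw [hswap, ← lintegral_add_right _ hmeas, lintegral_lintegral_swap hg.aemeasurable]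
  refine setLIntegral_congr_fun measurableSet_Ioi fun y hy => ?_
  have hcy : 0 < c * y := mul_pos hc hy
  rw [add_comm, ← Ioc_union_Ioi_eq_Ioi hcy.le,
    lintegral_union measurableSet_Ioi (Ioc_disjoint_Ioi le_rfl), setLIntegral_congr Ioo_ae_eq_Ioc]

open MeasureTheory Set in
/-- Subdivision of a two-dimensional cone by the ray through `(α, β)`. -/
theorem lintegral_quadrant_split {g : ℝ → ℝ → ENNReal} (hg : Measurable (Function.uncurry g))
    {α β : ℝ} (hα : 0 ≤ α) (hβ : 0 ≤ β) (hαβ : 0 < α + β) :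
    ∫⁻ x in Ioi 0, ∫⁻ y in Ioi 0, g x y =
      ENNReal.ofReal β * (∫⁻ x in Ioi 0, ∫⁻ t in Ioi 0, g (x + t * α) (t * β)) +
        ENNReal.ofReal α * ∫⁻ t in Ioi 0, ∫⁻ y in Ioi 0, g (t * α) (y + t * β) := by
  rcases hα.eq_or_lt with rfl | hα'
  · have hβ' : 0 < β := by linarith
    simp only [mul_zero, add_zero, ENNReal.ofReal_zero, zero_mul, mul_comm _ β]
    rw [← lintegral_const_mul' _ _ ENNReal.ofReal_ne_top]
    exact lintegral_congr fun x => (ofReal_mul_lintegral_Ioi_comp_mul hβ' (fun t => g x t)).symm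
  rcases hβ.eq_or_lt with rfl | hβ'
  · simp only [mul_zero, add_zero, ENNReal.ofReal_zero, zero_mul, zero_add, mul_comm _ α]
    rw [ofReal_mul_lintegral_Ioi_comp_mul hα' (fun t => ∫⁻ y in Ioi 0, g t y)]
  -- The factor `β` is the Jacobian of `(x, t) ↦ (x + t α, t β)`; in `h2` the factor `α` plays the
  -- same role on the other side of the ray.
  have h1 : ENNReal.ofReal β * (∫⁻ x in Ioi 0, ∫⁻ t in Ioi 0, g (x + t * α) (t * β)) =
      ∫⁻ y in Ioi 0, ∫⁻ x in Ioi (α / β * y), g x y := by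
    rw [lintegral_lintegral_swap (f := fun x t => g (x + t * α) (t * β))
      (Measurable.aemeasurable (hg.comp (f := fun p : ℝ × ℝ => (p.1 + p.2 * α, p.2 * β))
        (by fun_prop))),
      ← ofReal_mul_lintegral_Ioi_comp_mul hβ' (fun y => ∫⁻ x in Ioi (α / β * y), g x y)]
    congr 1
    refine lintegral_congr fun t => ?_
    rw [lintegral_Ioi_comp_add (t * α) (fun x => g x (t * β)), mul_comm t β,
      show α / β * (β * t) = t * α by field_simp]
  have h2 : ENNReal.ofReal α * (∫⁻ t in Ioi 0, ∫⁻ y in Ioi 0, g (t * α) (y + t * β)) =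
      ∫⁻ x in Ioi 0, ∫⁻ y in Ioi ((α / β)⁻¹ * x), g x y := by
    rw [← ofReal_mul_lintegral_Ioi_comp_mul hα' (fun x => ∫⁻ y in Ioi ((α / β)⁻¹ * x), g x y)]
    congr 1
    refine lintegral_congr fun t => ?_
    rw [lintegral_Ioi_comp_add (t * β) (fun y => g (t * α) y), mul_comm t α,
      show (α / β)⁻¹ * (α * t) = t * β by field_simp]
  rw [h1, h2]
  exact lintegral_quadrant_eq_add hg (div_pos hα' hβ')

open MeasureTheory Set in
/-- The integral of `h` over the cone generated by three vectors, in the coordinates given by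
these vectors. -/
noncomputable def coneIntegral (h : ℝ × ℝ × ℝ → ENNReal) (p q r : ℝ × ℝ × ℝ) : ENNReal :=
  ∫⁻ x in Ioi (0 : ℝ), ∫⁻ y in Ioi (0 : ℝ), ∫⁻ z in Ioi (0 : ℝ), h (x • p + y • q + z • r)

open MeasureTheory Set in
theorem coneIntegral_swap_right {h : ℝ × ℝ × ℝ → ENNReal} (hh : Measurable h)
    (p q r : ℝ × ℝ × ℝ) : coneIntegral h p q r = coneIntegral h p r q := by
  unfold coneIntegral
  refine lintegral_congr fun x => ?_
  rw [lintegral_lintegral_swap (f := fun y z => h (x • p + y • q + z • r))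
    (Measurable.aemeasurable (hh.comp (f := fun w : ℝ × ℝ => x • p + w.1 • q + w.2 • r)
      (by fun_prop)))]
  exact lintegral_congr fun y => lintegral_congr fun z => by rw [add_right_comm]

open MeasureTheory Set in
theorem coneIntegral_swap_left {h : ℝ × ℝ × ℝ → ENNReal} (hh : Measurable h)
    (p q r : ℝ × ℝ × ℝ) : coneIntegral h p q r = coneIntegral h q p r := by
  unfold coneIntegral
  rw [lintegral_lintegral_swap (f := fun x y => ∫⁻ z in Ioi (0 : ℝ), h (x • p + y • q + z • r))]
  · exact lintegral_congr fun y => lintegral_congr fun x => lintegral_congr fun z => by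
      rw [add_comm (x • p)]
  · refine Measurable.aemeasurable (Measurable.lintegral_prod_right'
      (f := fun w : (ℝ × ℝ) × ℝ => h (w.1.1 • p + w.1.2 • q + w.2 • r)) (hh.comp ?_))
    fun_prop

open MeasureTheory Set in
theorem coneIntegral_split_right {h : ℝ × ℝ × ℝ → ENNReal} (hh : Measurable h)
    (p q r : ℝ × ℝ × ℝ) {w : ℝ × ℝ × ℝ} {α β : ℝ} (hα : 0 ≤ α) (hβ : 0 ≤ β) (hαβ : 0 < α + β)
    (hw : w = α • q + β • r) :
    coneIntegral h p q r =
      ENNReal.ofReal β * coneIntegral h p q w + ENNReal.ofReal α * coneIntegral h p w r := by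
  unfold coneIntegral
  have hm : ∀ q r : ℝ × ℝ × ℝ, Measurable fun x : ℝ =>
      ∫⁻ y in Ioi (0 : ℝ), ∫⁻ z in Ioi (0 : ℝ), h (x • p + y • q + z • r) := by
    intro q r
    refine Measurable.lintegral_prod_right' (f := fun w : ℝ × ℝ =>
      ∫⁻ z in Ioi (0 : ℝ), h (w.1 • p + w.2 • q + z • r)) ?_
    refine Measurable.lintegral_prod_right'
      (f := fun w : (ℝ × ℝ) × ℝ => h (w.1.1 • p + w.1.2 • q + w.2 • r)) (hh.comp ?_)
    fun_prop
  rw [← lintegral_const_mul _ (hm _ _), ← lintegral_const_mul _ (hm _ _),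
    ← lintegral_add_left ((hm _ _).const_mul _)]
  refine lintegral_congr fun x => ?_
  rw [lintegral_quadrant_split (g := fun y z => h (x • p + y • q + z • r))
    (hh.comp (by fun_prop)) hα hβ hαβ]
  congr 2 <;>
  · refine lintegral_congr fun y => lintegral_congr fun t => ?_
    congr 1
    rw [hw]
    module

theorem coneIntegral_split_left {h : ℝ × ℝ × ℝ → ENNReal} (hh : Measurable h)
    (p q r : ℝ × ℝ × ℝ) {w : ℝ × ℝ × ℝ} {α β : ℝ} (hα : 0 ≤ α) (hβ : 0 ≤ β) (hαβ : 0 < α + β)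
    (hw : w = α • p + β • r) :
    coneIntegral h p q r =
      ENNReal.ofReal β * coneIntegral h p q w + ENNReal.ofReal α * coneIntegral h w q r := by
  rw [coneIntegral_swap_left hh, coneIntegral_split_right hh q p r hα hβ hαβ hw,
    coneIntegral_swap_left hh q, coneIntegral_swap_left hh q]

/-- The value of the integral of `(n - W)₊ (n - H)₊` over a simplicial cone on which `W` and `H` are
linear, with values `w₁, w₂, w₃` and `w₁ r₁, w₂ r₂, w₃ r₃` on the generators. -/
noncomputable def coneValue (n w₁ w₂ w₃ r₁ r₂ r₃ : ℝ) : ℝ :=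
  n ^ 5 / (24 * (w₁ * w₂ * w₃)) * (1 - (r₁ + r₂ + r₃) / 5)

theorem coneValue_nonneg {n w₁ w₂ w₃ r₁ r₂ r₃ : ℝ} (hn : 0 ≤ n) (hw₁ : 0 < w₁) (hw₂ : 0 < w₂)
    (hw₃ : 0 < w₃) (hr₁ : r₁ ≤ 1) (hr₂ : r₂ ≤ 1) (hr₃ : r₃ ≤ 1) :
    0 ≤ coneValue n w₁ w₂ w₃ r₁ r₂ r₃ :=
  mul_nonneg (by positivity) (by linarith)

-- The second factor needs no positive part: `rᵢ ≤ 1` means that its linear form is at most the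
-- first one, so it is nonnegative wherever the first factor is nonzero. The variables are
-- integrated out one at a time, and the exponent rises by one each time.
open MeasureTheory Set in
theorem lintegral_octant_linear {n w₁ w₂ w₃ r₁ r₂ r₃ : ℝ} (hn : 0 ≤ n) (hw₁ : 0 < w₁)
    (hw₂ : 0 < w₂) (hw₃ : 0 < w₃) (hr₁ : r₁ ≤ 1) (hr₂ : r₂ ≤ 1) (hr₃ : r₃ ≤ 1) :
    ∫⁻ x in Ioi (0 : ℝ), ∫⁻ y in Ioi (0 : ℝ), ∫⁻ z in Ioi (0 : ℝ),
      ENNReal.ofReal (max (n - (x * w₁ + y * w₂ + z * w₃)) 0 *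
        (n - (x * (w₁ * r₁) + y * (w₂ * r₂) + z * (w₃ * r₃)))) =
      ENNReal.ofReal (coneValue n w₁ w₂ w₃ r₁ r₂ r₃) := by
  have step3 : ∀ x ∈ Ioi (0 : ℝ), ∀ y ∈ Ioi (0 : ℝ), ∫⁻ z in Ioi (0 : ℝ),
      ENNReal.ofReal (max (n - (x * w₁ + y * w₂ + z * w₃)) 0 *
        (n - (x * (w₁ * r₁) + y * (w₂ * r₂) + z * (w₃ * r₃)))) =
      ENNReal.ofReal (max (n - x * w₁ - w₂ * y) 0 ^ (0 + 1 + 1) *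
        ((n - x * (w₁ * r₁) - r₃ / 3 * (n - x * w₁)) / (2 * w₃)
          - w₂ * (r₂ - r₃ / 3) / (2 * w₃) * y)) := by
    intro x hx y hy
    have hx : 0 < x := hx
    have hy : 0 < y := hy
    have h := lintegral_Ioi_max_pow_mul 0 (A := n - x * w₁ - w₂ * y)
      (B := n - x * (w₁ * r₁) - w₂ * r₂ * y) (h := w₃ * r₃) hw₃ ?_
    · convert h using 2
      · ext z
        ring_nf
      · push_cast
        field_simp
        ring_nf
    · intro hA
      have p1 : 0 ≤ x * w₁ * (1 - r₁) := mul_nonneg (by positivity) (by linarith)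
      have p2 : 0 ≤ w₂ * y * (1 - r₂) := mul_nonneg (by positivity) (by linarith)
      have p3 : 0 ≤ (n - x * w₁ - w₂ * y) * (1 - r₃) := mul_nonneg hA (by linarith)
      refine ⟨by linarith, ?_⟩
      rw [show w₃ * r₃ * ((n - x * w₁ - w₂ * y) / w₃) = r₃ * (n - x * w₁ - w₂ * y) by field_simp]
      linarith
  have step2 : ∀ x ∈ Ioi (0 : ℝ), ∫⁻ y in Ioi (0 : ℝ), ∫⁻ z in Ioi (0 : ℝ),
      ENNReal.ofReal (max (n - (x * w₁ + y * w₂ + z * w₃)) 0 *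
        (n - (x * (w₁ * r₁) + y * (w₂ * r₂) + z * (w₃ * r₃)))) =
      ENNReal.ofReal (max (n - w₁ * x) 0 ^ (1 + 1 + 1) *
        (n * (1 - (r₂ + r₃) / 4) / (6 * w₂ * w₃)
          - w₁ * (r₁ - (r₂ + r₃) / 4) / (6 * w₂ * w₃) * x)) := by
    intro x hx
    rw [setLIntegral_congr_fun measurableSet_Ioi (step3 x hx)]
    have hx : 0 < x := hx
    rw [lintegral_Ioi_max_pow_mul 1 hw₂]
    · congr 1
      push_cast
      rw [mul_comm x w₁]
      field_simp
      ring
    · intro hA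
      have p1 : 0 ≤ x * w₁ * (1 - r₁) := mul_nonneg (by positivity) (by linarith)
      have p2 : 0 ≤ (n - x * w₁) * (1 - r₂) := mul_nonneg hA (by linarith)
      have p3 : 0 ≤ (n - x * w₁) * (1 - r₃) := mul_nonneg hA (by linarith)
      refine ⟨div_nonneg (by linarith) (by positivity), ?_⟩
      rw [show (n - x * (w₁ * r₁) - r₃ / 3 * (n - x * w₁)) / (2 * w₃)
        - w₂ * (r₂ - r₃ / 3) / (2 * w₃) * ((n - x * w₁) / w₂) =
        (n - x * w₁ * r₁ - r₂ * (n - x * w₁)) / (2 * w₃) by field_simp; ring]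
      exact div_nonneg (by linarith) (by positivity)
  rw [setLIntegral_congr_fun measurableSet_Ioi step2, lintegral_Ioi_max_pow_mul 2 hw₁]
  · congr 1
    rw [max_eq_left hn, coneValue]
    push_cast
    field_simp
    ring
  · intro _
    have p1 : 0 ≤ n * (1 - r₁) := mul_nonneg hn (by linarith)
    have p2 : 0 ≤ n * (1 - r₂) := mul_nonneg hn (by linarith)
    have p3 : 0 ≤ n * (1 - r₃) := mul_nonneg hn (by linarith)
    refine ⟨div_nonneg (by linarith) (by positivity), ?_⟩
    rw [show n * (1 - (r₂ + r₃) / 4) / (6 * w₂ * w₃)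
      - w₁ * (r₁ - (r₂ + r₃) / 4) / (6 * w₂ * w₃) * (n / w₁) =
      n * (1 - r₁) / (6 * w₂ * w₃) by field_simp; ring]
    exact div_nonneg p1 (by positivity)

open MeasureTheory Set in
theorem coneIntegral_eq_coneValue {h : ℝ × ℝ × ℝ → ENNReal} {p q r : ℝ × ℝ × ℝ}
    {n w₁ w₂ w₃ r₁ r₂ r₃ : ℝ} (hn : 0 ≤ n) (hw₁ : 0 < w₁)
    (hw₂ : 0 < w₂) (hw₃ : 0 < w₃) (hr₁ : r₁ ≤ 1) (hr₂ : r₂ ≤ 1) (hr₃ : r₃ ≤ 1)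
    (hh : ∀ x y z : ℝ, 0 < x → 0 < y → 0 < z → h (x • p + y • q + z • r) =
      ENNReal.ofReal (max (n - (x * w₁ + y * w₂ + z * w₃)) 0 *
        max (n - (x * (w₁ * r₁) + y * (w₂ * r₂) + z * (w₃ * r₃))) 0)) :
    coneIntegral h p q r = ENNReal.ofReal (coneValue n w₁ w₂ w₃ r₁ r₂ r₃) := by
  rw [← lintegral_octant_linear hn hw₁ hw₂ hw₃ hr₁ hr₂ hr₃, coneIntegral]
  refine setLIntegral_congr_fun measurableSet_Ioi fun x hx =>
    setLIntegral_congr_fun measurableSet_Ioi fun y hy =>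
    setLIntegral_congr_fun measurableSet_Ioi fun z hz => ?_
  have hx : 0 < x := hx
  have hy : 0 < y := hy
  have hz : 0 < z := hz
  rw [hh x y z hx hy hz]
  congr 1
  rcases le_total (n - (x * w₁ + y * w₂ + z * w₃)) 0 with h0 | h0
  · rw [max_eq_right h0, zero_mul, zero_mul]
  · have p1 : 0 ≤ x * w₁ * (1 - r₁) := mul_nonneg (by positivity) (by linarith)
    have p2 : 0 ≤ y * w₂ * (1 - r₂) := mul_nonneg (by positivity) (by linarith)
    have p3 : 0 ≤ z * w₃ * (1 - r₃) := mul_nonneg (by positivity) (by linarith)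
    rw [max_eq_left (a := n - (x * (w₁ * r₁) + y * (w₂ * r₂) + z * (w₃ * r₃))) (by linarith)]

open MeasureTheory Set in
/-- The integral of `boxWeight` over the octant. -/
theorem coneIntegral_boxWeight {n a b : ℝ} (hn : 0 ≤ n) (ha : 0 < a) (hb : 0 ≤ b) (hba : b ≤ a) :
    coneIntegral (fun v => ENNReal.ofReal (boxWeight n a b v.1 v.2.1 v.2.2))
      (1, 0, 0) (0, 1, 0) (0, 0, 1) = ENNReal.ofReal (n ^ 5 * (trapeziumF a b / 2)) := by
  set h : ℝ × ℝ × ℝ → ENNReal := fun v => ENNReal.ofReal (boxWeight n a b v.1 v.2.1 v.2.2)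
  have hm : Measurable h := by
    refine ENNReal.measurable_ofReal.comp (Continuous.measurable ?_)
    unfold boxWeight
    fun_prop
  have hab : 0 ≤ a - b := sub_nonneg.2 hba
  have hsq : 0 ≤ a ^ 2 - b ^ 2 := by nlinarith
  have hsq' : 0 ≤ a ^ 2 - a * b := by nlinarith
  have hab0 : 0 ≤ a * b := mul_nonneg ha.le hb
  -- the three linear regimes
  have reg1 : ∀ x y z : ℝ, z * b ≤ y * a → z * a ≤ y * b → boxWeight n a b x y z =
      max (n - (x * a + y * a + y * a)) 0 * max (n - (x * b + y * b + y * b)) 0 := by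
    intro x y z h1 h2
    rw [boxWeight, max_eq_left h1, max_eq_left h2]
  have reg2 : ∀ x y z : ℝ, z * b ≤ y * a → y * b ≤ z * a → boxWeight n a b x y z =
      max (n - (x * a + y * a + y * a)) 0 * max (n - (x * b + y * b + z * a)) 0 := by
    intro x y z h1 h2
    rw [boxWeight, max_eq_left h1, max_eq_right h2]
  have reg3 : ∀ x y z : ℝ, y * a ≤ z * b → y * b ≤ z * a → boxWeight n a b x y z =
      max (n - (x * a + y * a + z * b)) 0 * max (n - (x * b + y * b + z * a)) 0 := by
    intro x y z h1 h2
    rw [boxWeight, max_eq_right h1, max_eq_right h2]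
  have hr : b / a ≤ 1 := by rw [div_le_one ha]; exact hba
  have hs : 0 < a + b := by positivity
  have hr₂ : 2 * a * b / (a ^ 2 + b ^ 2) ≤ 1 := by
    rw [div_le_one (by positivity)]
    nlinarith [sq_nonneg (a - b)]
  -- The generators lie on the walls where a formula changes or the larger side does: `(0, a, b)` on
  -- `y b = z a`; `(0, b, a)` on `y a = z b`; `(1, 0, 1)` and `(0, a (a + b), (2 a - b)(a + b))` on
  -- `W = H`; and `(a - b, b, a)` on both `y a = z b` and `W = H`. A generator with `W = H` has
  -- ratio `1`.
  have c1 : coneIntegral h (1, 0, 0) (0, 1, 0) (0, a, b) =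
      ENNReal.ofReal (coneValue n a (2 * a) (2 * a ^ 2) (b / a) (b / a) (b / a)) := by
    refine coneIntegral_eq_coneValue hn ha (by positivity) (by positivity) hr hr hr
      fun x y z hx hy hz => ?_
    simp only [h, Prod.smul_mk, Prod.mk_add_mk, smul_eq_mul]
    rw [reg1]
    · congr 2
      · congr 1; ring
      · congr 1; field_simp; ring
    · nlinarith [mul_nonneg hy.le ha.le, mul_nonneg hz.le hsq]
    · nlinarith [mul_nonneg hy.le hb]
  have c2 : coneIntegral h (1, 0, 0) (0, a, b) (0, a * (a + b), (2 * a - b) * (a + b)) =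
      ENNReal.ofReal (coneValue n a (2 * a ^ 2) (2 * a ^ 2 * (a + b)) (b / a) (b / a) 1) := by
    refine coneIntegral_eq_coneValue hn ha (by positivity) (by positivity) hr hr le_rfl
      fun x y z hx hy hz => ?_
    simp only [h, Prod.smul_mk, Prod.mk_add_mk, smul_eq_mul]
    rw [reg2]
    · congr 2
      · congr 1; ring
      · congr 1; field_simp; ring
    · nlinarith [mul_nonneg hy.le hsq, mul_nonneg hz.le (mul_nonneg hs.le (sq_nonneg (a - b)))]
    · nlinarith [mul_nonneg (mul_nonneg hz.le ha.le) (mul_nonneg hs.le hab)]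
  have c3 : coneIntegral h (1, 0, 0) (0, a * (a + b), (2 * a - b) * (a + b)) (a - b, b, a) =
      ENNReal.ofReal (coneValue n a (2 * a ^ 2 * (a + b)) (a * (a + b)) (b / a) 1 1) := by
    refine coneIntegral_eq_coneValue hn ha (by positivity) (by positivity) hr le_rfl le_rfl
      fun x y z hx hy hz => ?_
    simp only [h, Prod.smul_mk, Prod.mk_add_mk, smul_eq_mul]
    rw [reg2]
    · congr 2
      · congr 1; ring
      · congr 1; field_simp; ring
    · nlinarith [mul_nonneg hy.le (mul_nonneg hs.le (sq_nonneg (a - b)))]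
    · nlinarith [mul_nonneg (mul_nonneg hy.le ha.le) (mul_nonneg hs.le hab),
        mul_nonneg hz.le hsq]
  have c4 : coneIntegral h (a - b, b, a) (0, a * (a + b), (2 * a - b) * (a + b)) (0, b, a) =
      ENNReal.ofReal (coneValue n (a * (a + b)) (2 * a ^ 2 * (a + b)) (a ^ 2 + b ^ 2) 1 1
        (2 * a * b / (a ^ 2 + b ^ 2))) := by
    refine coneIntegral_eq_coneValue hn (by positivity) (by positivity) (by positivity) le_rfl
      le_rfl hr₂ fun x y z hx hy hz => ?_
    simp only [h, Prod.smul_mk, Prod.mk_add_mk, smul_eq_mul]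
    -- On this cone `H ≥ W`, so the two factors exchange roles; the same happens in `c6` and `c7`.
    rw [reg2, mul_comm]
    · congr 2
      · congr 1; ring
      · congr 1; field_simp; ring
    · nlinarith [mul_nonneg hy.le (mul_nonneg hs.le (sq_nonneg (a - b)))]
    · nlinarith [mul_nonneg (mul_nonneg hy.le ha.le) (mul_nonneg hs.le hab),
        mul_nonneg hz.le hsq, mul_nonneg hx.le hsq]
  have c5 : coneIntegral h (1, 0, 0) (a - b, b, a) (1, 0, 1) =
      ENNReal.ofReal (coneValue n a (a * (a + b)) (a + b) (b / a) 1 1) := by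
    refine coneIntegral_eq_coneValue hn ha (by positivity) (by positivity) hr le_rfl le_rfl
      fun x y z hx hy hz => ?_
    simp only [h, Prod.smul_mk, Prod.mk_add_mk, smul_eq_mul]
    rw [reg3]
    · congr 2
      · congr 1; ring
      · congr 1; field_simp; ring
    · nlinarith [mul_nonneg hz.le hb]
    · nlinarith [mul_nonneg hy.le hsq, mul_nonneg hz.le ha.le]
  have c6 : coneIntegral h (1, 0, 1) (a - b, b, a) (0, 0, 1) =
      ENNReal.ofReal (coneValue n (a + b) (a * (a + b)) a 1 1 (b / a)) := by
    refine coneIntegral_eq_coneValue hn (by positivity) (by positivity) ha le_rfl le_rfl hr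
      fun x y z hx hy hz => ?_
    simp only [h, Prod.smul_mk, Prod.mk_add_mk, smul_eq_mul]
    rw [reg3, mul_comm]
    · congr 2
      · congr 1; ring
      · congr 1; field_simp; ring
    · nlinarith [mul_nonneg hz.le hb, mul_nonneg hx.le hb]
    · nlinarith [mul_nonneg hy.le hsq, mul_nonneg hz.le ha.le, mul_nonneg hx.le ha.le]
  have c7 : coneIntegral h (a - b, b, a) (0, b, a) (0, 0, 1) =
      ENNReal.ofReal (coneValue n (a * (a + b)) (a ^ 2 + b ^ 2) a 1
        (2 * a * b / (a ^ 2 + b ^ 2)) (b / a)) := by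
    refine coneIntegral_eq_coneValue hn (by positivity) (by positivity) ha le_rfl
      hr₂ hr fun x y z hx hy hz => ?_
    simp only [h, Prod.smul_mk, Prod.mk_add_mk, smul_eq_mul]
    rw [reg3, mul_comm]
    · congr 2
      · congr 1; ring
      · congr 1; field_simp; ring
    · nlinarith [mul_nonneg hz.le hb]
    · nlinarith [mul_nonneg hy.le hsq, mul_nonneg hx.le hsq, mul_nonneg hz.le ha.le]
  have hα : 0 ≤ b / a := by positivity
  have hβ : 0 ≤ (a ^ 2 - b ^ 2) / a := div_nonneg hsq ha.le
  -- First the octant is cut along the walls `y b = z a` and `y a = z b`, then each piece met by `W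
  -- = H` is cut along it. Some weights vanish when `b = 0` or `a = b`, but the splitting formula
  -- covers these cases, so the axis and diagonal directions need no separate treatment.
  rw [coneIntegral_split_right hm _ _ _ (w := (0, a, b)) ha.le hb (by linarith)
      (by ext <;> simp),
    coneIntegral_split_right hm _ (0, a, b) _ (w := (0, b, a)) hα hβ ?_
      (by ext <;> simp <;> field_simp <;> ring),
    coneIntegral_split_right hm _ (0, a, b) (0, b, a)
      (w := (0, a * (a + b), (2 * a - b) * (a + b))) hab (by positivity : 0 ≤ 2 * a)
      (by linarith) (by ext <;> simp <;> ring),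
    coneIntegral_split_left hm (1, 0, 0) (0, a * (a + b), (2 * a - b) * (a + b)) (0, b, a)
      (w := (a - b, b, a)) hab zero_le_one (by linarith) (by ext <;> simp),
    coneIntegral_swap_right hm (1, 0, 0) (0, b, a),
    coneIntegral_split_left hm (1, 0, 0) (0, 0, 1) (0, b, a)
      (w := (a - b, b, a)) hab zero_le_one (by linarith) (by ext <;> simp),
    coneIntegral_swap_right hm (1, 0, 0) (0, 0, 1), coneIntegral_swap_right hm _ (0, 0, 1),
    coneIntegral_split_left hm (1, 0, 0) (a - b, b, a) (0, 0, 1)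
      (w := (1, 0, 1)) zero_le_one zero_le_one (by norm_num) (by ext <;> simp),
    c1, c2, c3, c4, c5, c6, c7]
  · have v1 : 0 ≤ coneValue n a (2 * a) (2 * a ^ 2) (b / a) (b / a) (b / a) :=
      coneValue_nonneg hn ha (by positivity) (by positivity) hr hr hr
    have v2 : 0 ≤ coneValue n a (2 * a ^ 2) (2 * a ^ 2 * (a + b)) (b / a) (b / a) 1 :=
      coneValue_nonneg hn ha (by positivity) (by positivity) hr hr le_rfl
    have v3 : 0 ≤ coneValue n a (2 * a ^ 2 * (a + b)) (a * (a + b)) (b / a) 1 1 :=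
      coneValue_nonneg hn ha (by positivity) (by positivity) hr le_rfl le_rfl
    have v4 : 0 ≤ coneValue n (a * (a + b)) (2 * a ^ 2 * (a + b)) (a ^ 2 + b ^ 2) 1 1
        (2 * a * b / (a ^ 2 + b ^ 2)) :=
      coneValue_nonneg hn (by positivity) (by positivity) (by positivity) le_rfl le_rfl hr₂
    have v5 : 0 ≤ coneValue n a (a * (a + b)) (a + b) (b / a) 1 1 :=
      coneValue_nonneg hn ha (by positivity) (by positivity) hr le_rfl le_rfl
    have v6 : 0 ≤ coneValue n (a + b) (a * (a + b)) a 1 1 (b / a) :=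
      coneValue_nonneg hn (by positivity) (by positivity) ha le_rfl le_rfl hr
    have v7 : 0 ≤ coneValue n (a * (a + b)) (a ^ 2 + b ^ 2) a 1
        (2 * a * b / (a ^ 2 + b ^ 2)) (b / a) :=
      coneValue_nonneg hn (by positivity) (by positivity) ha le_rfl hr₂ hr
    have comb : ∀ {α β s t : ℝ}, 0 ≤ α → 0 ≤ β → 0 ≤ s → 0 ≤ t →
        ENNReal.ofReal β * ENNReal.ofReal s + ENNReal.ofReal α * ENNReal.ofReal t =
          ENNReal.ofReal (β * s + α * t) := by
      intro α β s t h1 h2 h3 h4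
      rw [← ENNReal.ofReal_mul h2, ← ENNReal.ofReal_mul h1, ← ENNReal.ofReal_add] <;> positivity
    have h2a : 0 ≤ 2 * a := by positivity
    rw [comb hab zero_le_one v3 v4, comb zero_le_one zero_le_one v5 v6,
      comb hab h2a v2 (by positivity), comb hab zero_le_one (by positivity) v7,
      comb hα hβ (by positivity) (by positivity), comb ha.le hb v1 (by positivity)]
    congr 1
    simp only [coneValue, trapeziumF]
    field_simp
    ring
  · rw [← add_div]
    exact div_pos (by nlinarith [sq_nonneg (a - b)]) ha

/-! ### Riemann sums of the box weight -/

open MeasureTheory Set in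
theorem abs_sum_sub_integral_le {g : ℝ → ℝ} (hg : Continuous g) {K : ℝ}
    (hK : ∀ x y, 0 ≤ x → 0 ≤ y → |g x - g y| ≤ K * |x - y|) (N : ℕ) {θ : ℝ} (h0 : 0 ≤ θ)
    (h1 : θ ≤ 1) :
    |∑ i ∈ Finset.range N, g (i + θ) - ∫ x in (0 : ℝ)..N, g x| ≤ N * K := by
  have hK0 : 0 ≤ K := by
    have := hK 1 0 zero_le_one le_rfl
    simp only [sub_zero, abs_one, mul_one] at this
    exact (abs_nonneg _).trans this
  have hint := intervalIntegral.sum_integral_adjacent_intervals (f := g) (μ := volume)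
    (a := fun i : ℕ => (i : ℝ)) (n := N) fun k _ => hg.intervalIntegrable _ _
  rw [Nat.cast_zero] at hint
  rw [← hint, ← Finset.sum_sub_distrib]
  refine (Finset.abs_sum_le_sum_abs _ _).trans ?_
  have : ∀ i ∈ Finset.range N, |g (i + θ) - ∫ x in (i : ℝ)..((i + 1 : ℕ) : ℝ), g x| ≤ K := by
    intro i _
    have hi : (0 : ℝ) ≤ i := by positivity
    have e : g (i + θ) - ∫ x in (i : ℝ)..((i + 1 : ℕ) : ℝ), g x =
        ∫ x in (i : ℝ)..((i + 1 : ℕ) : ℝ), (g (i + θ) - g x) := by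
      rw [intervalIntegral.integral_sub intervalIntegrable_const (hg.intervalIntegrable _ _)]
      simp
    rw [e, ← Real.norm_eq_abs]
    refine (intervalIntegral.norm_integral_le_of_norm_le_const (C := K) ?_).trans (by simp)
    intro x hx
    rw [uIoc_of_le (by push_cast; linarith)] at hx
    have hx2 := hx.2
    push_cast at hx2
    rw [Real.norm_eq_abs]
    refine (hK _ _ (by positivity) (hi.trans hx.1.le)).trans ?_
    refine mul_le_of_le_one_right hK0 ?_
    rw [abs_le]
    constructor <;> linarith [hx.1]
  refine (Finset.sum_le_sum this).trans ?_
  simp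

theorem abs_integral_sub_integral_le {g₁ g₂ : ℝ → ℝ} (h₁ : Continuous g₁) (h₂ : Continuous g₂)
    {N C : ℝ} (hN : 0 ≤ N) (hC : ∀ x, 0 ≤ x → |g₁ x - g₂ x| ≤ C) :
    |(∫ x in (0 : ℝ)..N, g₁ x) - ∫ x in (0 : ℝ)..N, g₂ x| ≤ N * C := by
  rw [← intervalIntegral.integral_sub (h₁.intervalIntegrable _ _) (h₂.intervalIntegrable _ _),
    ← Real.norm_eq_abs]
  refine (intervalIntegral.norm_integral_le_of_norm_le_const (C := C) ?_).trans ?_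
  · intro x hx
    rw [Set.uIoc_of_le hN] at hx
    exact hC x hx.1.le
  · rw [sub_zero, abs_of_nonneg hN, mul_comm]

theorem abs_sum_sub_integral_le_three {g : ℝ → ℝ → ℝ → ℝ}
    (hg : Continuous fun p : ℝ × ℝ × ℝ => g p.1 p.2.1 p.2.2) {K : ℝ}
    (hK : ∀ x y z x' y' z', 0 ≤ x → 0 ≤ y → 0 ≤ z → 0 ≤ x' → 0 ≤ y' → 0 ≤ z' →
      |g x y z - g x' y' z'| ≤ K * (|x - x'| + |y - y'| + |z - z'|))
    (N : ℕ) {θ₁ θ₂ θ₃ : ℝ} (h₁ : 0 ≤ θ₁) (h₁' : θ₁ ≤ 1) (h₂ : 0 ≤ θ₂) (h₂' : θ₂ ≤ 1)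
    (h₃ : 0 ≤ θ₃) (h₃' : θ₃ ≤ 1) :
    |∑ i ∈ Finset.range N, ∑ j ∈ Finset.range N, ∑ k ∈ Finset.range N,
        g (i + θ₁) (j + θ₂) (k + θ₃) -
      ∫ x in (0 : ℝ)..N, ∫ y in (0 : ℝ)..N, ∫ z in (0 : ℝ)..N, g x y z| ≤
      3 * (N : ℝ) ^ 3 * K := by
  have c3 : ∀ x y, Continuous fun z => g x y z := fun x y =>
    hg.comp (f := fun z => (x, y, z)) (by fun_prop)
  have c2' : Continuous fun p : ℝ × ℝ => ∫ z in (0 : ℝ)..N, g p.1 p.2 z :=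
    intervalIntegral.continuous_parametric_intervalIntegral_of_continuous'
      (f := fun (p : ℝ × ℝ) z => g p.1 p.2 z)
      (hg.comp (f := fun w : (ℝ × ℝ) × ℝ => (w.1.1, w.1.2, w.2)) (by fun_prop)) _ _
  have c2 : ∀ x, Continuous fun y => ∫ z in (0 : ℝ)..N, g x y z := fun x =>
    c2'.comp (f := fun y => (x, y)) (by fun_prop)
  have c1 : Continuous fun x => ∫ y in (0 : ℝ)..N, ∫ z in (0 : ℝ)..N, g x y z :=
    intervalIntegral.continuous_parametric_intervalIntegral_of_continuous' c2' _ _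
  have hN : (0 : ℝ) ≤ N := by positivity
  have lip2 : ∀ x y x' y' : ℝ, 0 ≤ x → 0 ≤ y → 0 ≤ x' → 0 ≤ y' →
      |(∫ z in (0 : ℝ)..N, g x y z) - ∫ z in (0 : ℝ)..N, g x' y' z| ≤
        N * (K * (|x - x'| + |y - y'|)) := by
    intro x y x' y' hx hy hx' hy'
    refine abs_integral_sub_integral_le (c3 x y) (c3 x' y') hN fun z hz => ?_
    simpa using hK x y z x' y' z hx hy hz hx' hy' hz
  have lip1 : ∀ x x' : ℝ, 0 ≤ x → 0 ≤ x' →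
      |(∫ y in (0 : ℝ)..N, ∫ z in (0 : ℝ)..N, g x y z) -
        ∫ y in (0 : ℝ)..N, ∫ z in (0 : ℝ)..N, g x' y z| ≤ N * (N * K) * |x - x'| := by
    intro x x' hx hx'
    refine (abs_integral_sub_integral_le (C := N * (K * |x - x'|)) (c2 x) (c2 x') hN
      fun y hy => ?_).trans (le_of_eq (by ring))
    simpa using lip2 x y x' y hx hy hx' hy
  have e1 := abs_sum_sub_integral_le c1 lip1 N h₁ h₁'
  have e2 : ∀ i ∈ Finset.range N,
      |∑ j ∈ Finset.range N, (∫ z in (0 : ℝ)..N, g (i + θ₁) (j + θ₂) z) -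
        ∫ y in (0 : ℝ)..N, ∫ z in (0 : ℝ)..N, g (i + θ₁) y z| ≤ N * (N * K) := by
    intro i _
    refine abs_sum_sub_integral_le (c2 _) (fun y y' hy hy' => ?_) N h₂ h₂'
    refine (lip2 _ y _ y' (by positivity) hy (by positivity) hy').trans (le_of_eq ?_)
    simp only [sub_self, abs_zero, zero_add]
    ring
  have e3 : ∀ i ∈ Finset.range N, ∀ j ∈ Finset.range N,
      |∑ k ∈ Finset.range N, g (i + θ₁) (j + θ₂) (k + θ₃) -
        ∫ z in (0 : ℝ)..N, g (i + θ₁) (j + θ₂) z| ≤ N * K := by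
    intro i _ j _
    refine abs_sum_sub_integral_le (c3 _ _) (fun z z' hz hz' => ?_) N h₃ h₃'
    refine (hK _ _ z _ _ z' (by positivity) (by positivity) hz (by positivity) (by positivity)
      hz').trans (le_of_eq ?_)
    simp only [sub_self, abs_zero, zero_add]
  have sum_bound : ∀ {φ ψ : ℕ → ℝ} {C : ℝ}, (∀ i ∈ Finset.range N, |φ i - ψ i| ≤ C) →
      |∑ i ∈ Finset.range N, φ i - ∑ i ∈ Finset.range N, ψ i| ≤ N * C := by
    intro φ ψ C h
    rw [← Finset.sum_sub_distrib]
    refine (Finset.abs_sum_le_sum_abs _ _).trans ((Finset.sum_le_sum h).trans ?_)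
    simp
  have s2 := sum_bound e2
  have s3 := sum_bound fun i hi => sum_bound (e3 i hi)
  rw [abs_le] at e1 s2 s3 ⊢
  constructor <;> linarith [e1.1, e1.2, s2.1, s2.2, s3.1, s3.2]

theorem continuous_boxWeight (n a b : ℝ) :
    Continuous fun p : ℝ × ℝ × ℝ => boxWeight n a b p.1 p.2.1 p.2.2 := by
  unfold boxWeight
  fun_prop

theorem boxWeight_nonneg (n a b x y z : ℝ) : 0 ≤ boxWeight n a b x y z :=
  mul_nonneg (le_max_right _ _) (le_max_right _ _)

/-- Both factors lie in `[0, n]` and are Lipschitz with constant `2 a`, so their product has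
constant `2 * n * (2 * a)`. -/
theorem abs_boxWeight_sub_le {n a b : ℝ} (hn : 0 ≤ n) (hb : 0 ≤ b) (hba : b ≤ a)
    (x y z x' y' z' : ℝ) (hx : 0 ≤ x) (hy : 0 ≤ y) (_ : 0 ≤ z) (hx' : 0 ≤ x') (hy' : 0 ≤ y')
    (_ : 0 ≤ z') :
    |boxWeight n a b x y z - boxWeight n a b x' y' z'| ≤
      4 * n * a * (|x - x'| + |y - y'| + |z - z'|) := by
  have ha : 0 ≤ a := hb.trans hba
  have side : ∀ c d : ℝ, 0 ≤ c → c ≤ a → 0 ≤ d → d ≤ a →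
      |max (n - (x * c + y * c + max (y * c) (z * d))) 0 -
        max (n - (x' * c + y' * c + max (y' * c) (z' * d))) 0| ≤
        2 * a * (|x - x'| + |y - y'| + |z - z'|) := by
    intro c d hc hca hd hda
    refine (abs_max_sub_max_le_abs _ _ _).trans ?_
    have hm := abs_max_sub_max_le_max (y * c) (z * d) (y' * c) (z' * d)
    have e1 : |x * c - x' * c| ≤ a * |x - x'| := by
      rw [← sub_mul, abs_mul, abs_of_nonneg hc, mul_comm]
      gcongr
    have e2 : |y * c - y' * c| ≤ a * |y - y'| := by
      rw [← sub_mul, abs_mul, abs_of_nonneg hc, mul_comm]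
      gcongr
    have e3 : |z * d - z' * d| ≤ a * |z - z'| := by
      rw [← sub_mul, abs_mul, abs_of_nonneg hd, mul_comm]
      gcongr
    have p1 : 0 ≤ a * |x - x'| := by positivity
    have p2 : 0 ≤ a * |y - y'| := by positivity
    have p3 : 0 ≤ a * |z - z'| := by positivity
    have hm' : |max (y * c) (z * d) - max (y' * c) (z' * d)| ≤ a * |y - y'| + a * |z - z'| :=
      hm.trans (max_le (by linarith) (by linarith))
    rw [abs_le] at e1 e2 hm' ⊢
    constructor <;> linarith [e1.1, e1.2, e2.1, e2.2, hm'.1, hm'.2]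
  have bd : ∀ x y z c d : ℝ, 0 ≤ x → 0 ≤ y → 0 ≤ c →
      max (n - (x * c + y * c + max (y * c) (z * d))) 0 ≤ n := by
    intro x y z c d hx hy hc
    refine max_le ?_ hn
    have := le_max_left (y * c) (z * d)
    have := mul_nonneg hx hc
    have := mul_nonneg hy hc
    linarith
  have s1 := side a b ha le_rfl hb hba
  have s2 := side b a hb hba ha le_rfl
  have b1 := bd x y z a b hx hy ha
  have b2 := bd x' y' z' b a hx' hy' hb
  unfold boxWeight
  set P := max (n - (x * a + y * a + max (y * a) (z * b))) 0
  set Q := max (n - (x * b + y * b + max (y * b) (z * a))) 0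
  set P' := max (n - (x' * a + y' * a + max (y' * a) (z' * b))) 0
  set Q' := max (n - (x' * b + y' * b + max (y' * b) (z' * a))) 0
  have hP : 0 ≤ P := le_max_right _ _
  have hQ' : 0 ≤ Q' := le_max_right _ _
  have e : P * Q - P' * Q' = P * (Q - Q') + Q' * (P - P') := by ring
  rw [e]
  refine (abs_add_le _ _).trans ?_
  rw [abs_mul, abs_mul, abs_of_nonneg hP, abs_of_nonneg hQ']
  have t1 := mul_le_mul b1 s2 (abs_nonneg _) hn
  have t2 := mul_le_mul b2 s1 (abs_nonneg _) hn
  linarith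

theorem boxWeight_eq_zero {n a b x y z : ℝ} (ha : 0 ≤ a) (hb : 0 ≤ b) (hx : 0 ≤ x)
    (hy : 0 ≤ y) (h : n ≤ x * a ∨ n ≤ y * a ∨ n ≤ z * a) :
    boxWeight n a b x y z = 0 := by
  have m1 := le_max_left (y * a) (z * b)
  have m2 := le_max_left (y * b) (z * a)
  have m3 := le_max_right (y * b) (z * a)
  have p1 := mul_nonneg hx ha
  have p2 := mul_nonneg hy ha
  have p3 := mul_nonneg hx hb
  have p4 := mul_nonneg hy hb
  unfold boxWeight
  rcases h with h | h | h
  · rw [max_eq_right (b := 0) (by linarith), zero_mul]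
  · rw [max_eq_right (b := 0) (by linarith), zero_mul]
  · rw [max_eq_right (a := n - (x * b + y * b + max (y * b) (z * a))) (by linarith), mul_zero]

open MeasureTheory Set in
theorem ofReal_intervalIntegral_eq_lintegral_Ioi {φ : ℝ → ℝ} (hφ : Continuous φ) {N : ℝ}
    (hN : 0 ≤ N) (h0 : ∀ x, 0 < x → 0 ≤ φ x) (hs : ∀ x, N < x → φ x = 0) :
    ENNReal.ofReal (∫ x in (0 : ℝ)..N, φ x) = ∫⁻ x in Ioi 0, ENNReal.ofReal (φ x) := by
  rw [intervalIntegral.integral_of_le hN, ofReal_integral_eq_lintegral_ofReal hφ.integrableOn_Ioc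
    ((ae_restrict_iff' measurableSet_Ioc).2 (Eventually.of_forall fun x hx => h0 x hx.1)),
    ← Ioc_union_Ioi_eq_Ioi hN, lintegral_union measurableSet_Ioi (Ioc_disjoint_Ioi le_rfl)]
  rw [setLIntegral_congr_fun (g := fun _ => 0) (s := Ioi N) measurableSet_Ioi
    (fun x hx => by simp [hs x hx]), lintegral_zero, add_zero]

theorem trapeziumF_nonneg {a b : ℝ} (ha : 0 ≤ a) (hb : 0 ≤ b) (hba : b ≤ a) :
    0 ≤ trapeziumF a b := by
  refine div_nonneg ?_ (by positivity)
  have h1 : a ^ 4 * b ^ 2 ≤ a ^ 4 * a ^ 2 := by gcongr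
  have h2 : a ^ 2 * b ^ 3 * b ≤ a ^ 2 * b ^ 3 * a := by gcongr
  have h3 : b ^ 3 * b ^ 3 ≤ b ^ 3 * a ^ 3 := by gcongr
  have h4 : 0 ≤ a ^ 6 := by positivity
  have h5 : 0 ≤ a ^ 5 * b := by positivity
  have h6 : 0 ≤ a * b ^ 5 := by positivity
  have h7 : 0 ≤ a ^ 3 * b ^ 3 := by positivity
  linarith

open MeasureTheory Set in
theorem integral_boxWeight {n a b N : ℝ} (hn : 0 ≤ n) (ha : 0 < a) (hb : 0 ≤ b) (hba : b ≤ a)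
    (hN : 0 ≤ N) (hNa : n ≤ N * a) :
    ∫ x in (0 : ℝ)..N, ∫ y in (0 : ℝ)..N, ∫ z in (0 : ℝ)..N, boxWeight n a b x y z =
      n ^ 5 * (trapeziumF a b / 2) := by
  have hg := continuous_boxWeight n a b
  have c3 : ∀ x y, Continuous fun z => boxWeight n a b x y z := fun x y =>
    hg.comp (f := fun z => (x, y, z)) (by fun_prop)
  have c2' : Continuous fun p : ℝ × ℝ => ∫ z in (0 : ℝ)..N, boxWeight n a b p.1 p.2 z :=
    intervalIntegral.continuous_parametric_intervalIntegral_of_continuous'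
      (f := fun (p : ℝ × ℝ) z => boxWeight n a b p.1 p.2 z)
      (hg.comp (f := fun w : (ℝ × ℝ) × ℝ => (w.1.1, w.1.2, w.2)) (by fun_prop)) _ _
  have c2 : ∀ x, Continuous fun y => ∫ z in (0 : ℝ)..N, boxWeight n a b x y z := fun x =>
    c2'.comp (f := fun y => (x, y)) (by fun_prop)
  have c1 : Continuous fun x => ∫ y in (0 : ℝ)..N, ∫ z in (0 : ℝ)..N, boxWeight n a b x y z :=
    intervalIntegral.continuous_parametric_intervalIntegral_of_continuous' c2' _ _
  have n3 : ∀ x y, 0 ≤ ∫ z in (0 : ℝ)..N, boxWeight n a b x y z := fun x y =>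
    intervalIntegral.integral_nonneg hN fun z _ => boxWeight_nonneg _ _ _ _ _ _
  have n2 : ∀ x, 0 ≤ ∫ y in (0 : ℝ)..N, ∫ z in (0 : ℝ)..N, boxWeight n a b x y z := fun x =>
    intervalIntegral.integral_nonneg hN fun y _ => n3 x y
  have far : ∀ t, N < t → n ≤ t * a := fun t ht =>
    hNa.trans (mul_le_mul_of_nonneg_right ht.le ha.le)
  have z2 : ∀ x, 0 < x → ∀ y, N < y → ∫ z in (0 : ℝ)..N, boxWeight n a b x y z = 0 := by
    intro x hx y hy
    rw [intervalIntegral.integral_congr (g := fun _ => 0), intervalIntegral.integral_zero]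
    intro z hz
    rw [uIcc_of_le hN] at hz
    exact boxWeight_eq_zero ha.le hb hx.le (hN.trans hy.le) (Or.inr (Or.inl (far y hy)))
  have z1 : ∀ x, N < x →
      ∫ y in (0 : ℝ)..N, ∫ z in (0 : ℝ)..N, boxWeight n a b x y z = 0 := by
    intro x hx
    rw [intervalIntegral.integral_congr (g := fun _ => 0), intervalIntegral.integral_zero]
    intro y hy
    beta_reduce
    rw [intervalIntegral.integral_congr (g := fun _ => 0), intervalIntegral.integral_zero]
    intro z hz
    rw [uIcc_of_le hN] at hz hy
    exact boxWeight_eq_zero ha.le hb (hN.trans hx.le) hy.1 (Or.inl (far x hx))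
  have hlin : ENNReal.ofReal
      (∫ x in (0 : ℝ)..N, ∫ y in (0 : ℝ)..N, ∫ z in (0 : ℝ)..N, boxWeight n a b x y z) =
      ENNReal.ofReal (n ^ 5 * (trapeziumF a b / 2)) := by
    rw [← coneIntegral_boxWeight hn ha hb hba, coneIntegral,
      ofReal_intervalIntegral_eq_lintegral_Ioi c1 hN (fun x _ => n2 x) z1]
    refine setLIntegral_congr_fun measurableSet_Ioi fun x hx => ?_
    have hx : 0 < x := hx
    rw [ofReal_intervalIntegral_eq_lintegral_Ioi (c2 x) hN (fun y _ => n3 x y) (z2 x hx)]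
    refine setLIntegral_congr_fun measurableSet_Ioi fun y hy => ?_
    have hy : 0 < y := hy
    rw [ofReal_intervalIntegral_eq_lintegral_Ioi (c3 x y) hN
      (fun z _ => boxWeight_nonneg _ _ _ _ _ _)
      (fun z hz => boxWeight_eq_zero ha.le hb hx.le hy.le
        (Or.inr (Or.inr (far z hz))))]
    refine setLIntegral_congr_fun measurableSet_Ioi fun z hz => ?_
    simp
  have hf := trapeziumF_nonneg ha.le hb hba
  rwa [ENNReal.ofReal_eq_ofReal_iff
    (intervalIntegral.integral_nonneg hN fun x _ => n2 x) (by positivity)] at hlin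

theorem sum_range_cube_eq {g : ℕ → ℕ → ℕ → ℝ} {N n : ℕ} (hN : N ≤ n)
    (h : ∀ i j k, N ≤ i ∨ N ≤ j ∨ N ≤ k → g i j k = 0) :
    ∑ i ∈ Finset.range n, ∑ j ∈ Finset.range n, ∑ k ∈ Finset.range n, g i j k =
      ∑ i ∈ Finset.range N, ∑ j ∈ Finset.range N, ∑ k ∈ Finset.range N, g i j k := by
  have key : ∀ φ : ℕ → ℝ, (∀ i, N ≤ i → φ i = 0) →
      ∑ i ∈ Finset.range n, φ i = ∑ i ∈ Finset.range N, φ i := by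
    intro φ hφ
    refine (Finset.sum_subset (Finset.range_mono hN) fun i _ hi => hφ i ?_).symm
    simpa using hi
  rw [key]
  · refine Finset.sum_congr rfl fun i _ => ?_
    rw [key]
    · exact Finset.sum_congr rfl fun j _ => key _ fun k hk => h i j k (Or.inr (Or.inr hk))
    · exact fun j hj => Finset.sum_eq_zero fun k _ => h i j k (Or.inr (Or.inl hj))
  · exact fun i hi => Finset.sum_eq_zero fun j _ => Finset.sum_eq_zero fun k _ =>
      h i j k (Or.inl hi)

/-- The weight vanishes outside a cube of side `N = ⌈n / a⌉ ≤ 2 n / a`. A cell-by-cell comparison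
there costs at most `3 N ^ 3` times the Lipschitz constant `4 n a`, which gives `96 n ^ 4 / a ^ 2`
for all sampling offsets in `[0, 1]`. -/
theorem abs_sum_boxWeight_sub_le {n a b : ℕ} (ha : 1 ≤ a) (han : a ≤ n) (hba : b ≤ a)
    {θ₂ θ₃ : ℝ} (h₂ : 0 ≤ θ₂) (h₂' : θ₂ ≤ 1) (h₃ : 0 ≤ θ₃) (h₃' : θ₃ ≤ 1) :
    |∑ l ∈ Finset.range n, ∑ j ∈ Finset.range n, ∑ m ∈ Finset.range n,
        boxWeight n a b (l + 1) (j + θ₂) (m + θ₃) - (n : ℝ) ^ 5 * (trapeziumF a b / 2)| ≤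
      96 * ((n : ℝ) ^ 4 / (a : ℝ) ^ 2) := by
  have ha' : (1 : ℝ) ≤ a := by exact_mod_cast ha
  have ha0 : (0 : ℝ) < a := by linarith
  have han' : (a : ℝ) ≤ n := by exact_mod_cast han
  have hba' : (b : ℝ) ≤ a := by exact_mod_cast hba
  have hn : (0 : ℝ) ≤ n := by positivity
  have hb : (0 : ℝ) ≤ b := by positivity
  obtain ⟨N, hN⟩ : ∃ N : ℕ, N = ⌈(n : ℝ) / a⌉₊ := ⟨_, rfl⟩
  have hNn : N ≤ n := by
    rw [hN]
    exact Nat.ceil_le.2 (div_le_self hn ha')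
  have hNa : (n : ℝ) ≤ N * a := by
    rw [← div_le_iff₀ ha0, hN]
    exact Nat.le_ceil _
  have hN2 : (N : ℝ) ≤ 2 * n / a := by
    have h1 : (N : ℝ) < n / a + 1 := by
      rw [hN]
      exact Nat.ceil_lt_add_one (by positivity)
    have h2 : (1 : ℝ) ≤ n / a := by rwa [le_div_iff₀ ha0, one_mul]
    rw [mul_div_assoc]
    linarith
  have far : ∀ (i : ℕ) (θ : ℝ), 0 ≤ θ → N ≤ i → (n : ℝ) ≤ (i + θ) * a := by
    intro i θ hθ hi
    have : (N : ℝ) ≤ i := by exact_mod_cast hi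
    exact hNa.trans (mul_le_mul_of_nonneg_right (by linarith) ha0.le)
  rw [sum_range_cube_eq hNn]
  · rw [← integral_boxWeight hn ha0 hb hba' (Nat.cast_nonneg N) hNa]
    refine (abs_sum_sub_integral_le_three (continuous_boxWeight n a b)
      (abs_boxWeight_sub_le hn hb hba') N zero_le_one le_rfl h₂ h₂' h₃ h₃').trans ?_
    have h3 : (N : ℝ) ^ 3 ≤ (2 * n / a) ^ 3 := by gcongr
    calc 3 * (N : ℝ) ^ 3 * (4 * n * a) ≤ 3 * (2 * n / a) ^ 3 * (4 * n * a) := by gcongr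
      _ = 96 * ((n : ℝ) ^ 4 / (a : ℝ) ^ 2) := by field_simp; ring
  · intro i j k h
    refine boxWeight_eq_zero ha0.le hb (by positivity) (by positivity) ?_
    rcases h with h | h | h
    · exact Or.inl (far i 1 zero_le_one h)
    · exact Or.inr (Or.inl (far j θ₂ h₂ h))
    · exact Or.inr (Or.inr (far k θ₃ h₃ h))

/-- Each available parity class contributes `f(a, b) / 2`. There are two classes when `a + b` is
even and one otherwise, which is what `(3 + (-1) ^ (a + b)) / 4` encodes. -/
theorem abs_shapeSum_sub_le {e n a b : ℕ} (he : e ≤ 2) (ha : 1 ≤ a) (han : a ≤ n) (hba : b ≤ a) :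
    |shapeSum e n a b - (3 + (-1 : ℝ) ^ (a + b)) / 4 * trapeziumF a b * (n : ℝ) ^ 5| ≤
      192 * ((n : ℝ) ^ 4 / (a : ℝ) ^ 2) := by
  have hshift : ∀ t, ∀ e : ℕ, e ≤ 2 → (parityShift e t : ℝ) / 2 ≤ 1 := by
    intro t e he
    have : parityShift e t ≤ 2 := by cases t <;> simp [parityShift, he]
    have : (parityShift e t : ℝ) ≤ 2 := by exact_mod_cast this
    linarith
  have key : ∀ t, _ := fun t => abs_sum_boxWeight_sub_le ha han hba
    (θ₂ := (parityShift e t : ℝ) / 2) (θ₃ := (parityShift 2 t : ℝ) / 2) (by positivity)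
    (hshift t e he) (by positivity) (hshift t 2 le_rfl)
  have k1 := key true
  have k2 := key false
  have hpos : 0 ≤ (n : ℝ) ^ 4 / (a : ℝ) ^ 2 := by positivity
  rw [shapeSum, Fintype.sum_bool, if_pos (c := false = true → _) (fun h => absurd h (by decide)),
    abs_le]
  rw [abs_le] at k1 k2
  by_cases hab : Even (a + b)
  · rw [if_pos (fun _ => hab), hab.neg_one_pow]
    constructor <;> linarith [k1.1, k1.2, k2.1, k2.2]
  · rw [if_neg (fun h => hab (h rfl)), (Nat.not_even_iff_odd.1 hab).neg_one_pow]
    constructor <;> linarith [k2.1, k2.2]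

/-! ### Reduction of the directions by symmetry -/

theorem sum_Icc_neg_natAbs (φ : ℕ → ℝ) (n : ℕ) :
    ∑ u ∈ Finset.Icc (-(n : ℤ)) n, φ u.natAbs = φ 0 + 2 * ∑ a ∈ Finset.Icc 1 n, φ a := by
  induction n with
  | zero => simp
  | succ n ih =>
    have h : Finset.Icc (-((n + 1 : ℕ) : ℤ)) ((n + 1 : ℕ) : ℤ) =
        insert (-((n + 1 : ℕ) : ℤ)) (insert ((n + 1 : ℕ) : ℤ) (Finset.Icc (-(n : ℤ)) n)) := by
      ext x
      simp only [Finset.mem_insert, Finset.mem_Icc]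
      omega
    rw [h, Finset.sum_insert, Finset.sum_insert, ih, Finset.sum_Icc_succ_top (by omega),
      Int.natAbs_neg, Int.natAbs_natCast]
    · ring
    · simp
    · simp only [Finset.mem_insert, Finset.mem_Icc]
      omega

theorem sum_Icc_sum_Icc_of_symm {Φ : ℕ → ℕ → ℝ} (h : ∀ a b, Φ a b = Φ b a) (n : ℕ) :
    ∑ a ∈ Finset.Icc 1 n, ∑ b ∈ Finset.Icc 1 n, Φ a b =
      ∑ a ∈ Finset.Icc 1 n, (Φ a a + 2 * ∑ b ∈ Finset.Ico 1 a, Φ a b) := by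
  induction n with
  | zero => simp
  | succ n ih =>
    have e : ∀ a, ∑ b ∈ Finset.Icc 1 (n + 1), Φ a b =
        ∑ b ∈ Finset.Icc 1 n, Φ a b + Φ a (n + 1) := fun a =>
      Finset.sum_Icc_succ_top (by omega) _
    have hI : Finset.Ico 1 (n + 1) = Finset.Icc 1 n := Finset.Ico_add_one_right_eq_Icc 1 n
    simp only [e]
    rw [Finset.sum_Icc_succ_top (by omega), Finset.sum_Icc_succ_top (by omega),
      Finset.sum_add_distrib, ih, hI, Finset.sum_congr rfl fun a _ => h a (n + 1)]
    ring

theorem boxWeight_comm (n a b x y z : ℝ) : boxWeight n a b x y z = boxWeight n b a x y z :=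
  mul_comm _ _

theorem shapeSum_comm (e n a b : ℕ) : shapeSum e n a b = shapeSum e n b a := by
  simp only [shapeSum, boxWeight_comm n a b, add_comm a b]

/-- The summand depends only on the unordered pair `|u|`, `|v|`. Coprimality leaves only `1` on the
axes and on the diagonal, with orbits of size four; all other orbits have size eight. -/
theorem sum_coprime_shapeSum (e : ℕ) {n : ℕ} (hn : 1 ≤ n) :
    (∑ u ∈ Finset.Icc (-(n : ℤ)) n, ∑ v ∈ Finset.Icc (-(n : ℤ)) n,
        if Nat.gcd u.natAbs v.natAbs = 1 then shapeSum e n u.natAbs v.natAbs else 0) =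
      4 * shapeSum e n 1 0 + 4 * shapeSum e n 1 1 +
        8 * ∑ a ∈ Finset.Icc 1 n, ∑ b ∈ (Finset.Ico 1 a).filter (fun b => Nat.gcd a b = 1),
          shapeSum e n a b := by
  set Φ : ℕ → ℕ → ℝ := fun a b => if Nat.gcd a b = 1 then shapeSum e n a b else 0 with hΦ
  have hsymm : ∀ a b, Φ a b = Φ b a := fun a b => by
    simp only [hΦ, Nat.gcd_comm a b, shapeSum_comm e n a b]
  have h1 : (1 : ℕ) ∈ Finset.Icc 1 n := Finset.mem_Icc.2 ⟨le_rfl, hn⟩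
  have hax : ∑ a ∈ Finset.Icc 1 n, Φ a 0 = shapeSum e n 1 0 := by
    rw [Finset.sum_eq_single_of_mem 1 h1]
    · simp [hΦ]
    · intro a _ ha
      simp [hΦ, ha]
  have hdiag : ∑ a ∈ Finset.Icc 1 n, Φ a a = shapeSum e n 1 1 := by
    rw [Finset.sum_eq_single_of_mem 1 h1]
    · simp [hΦ]
    · intro a _ ha
      simp [hΦ, ha]
  have h00 : Φ 0 0 = 0 := by simp [hΦ]
  have hrow : ∀ u : ℤ, ∑ v ∈ Finset.Icc (-(n : ℤ)) n, Φ u.natAbs v.natAbs =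
      Φ u.natAbs 0 + 2 * ∑ b ∈ Finset.Icc 1 n, Φ u.natAbs b := fun u =>
    sum_Icc_neg_natAbs (Φ u.natAbs) n
  change ∑ u ∈ Finset.Icc (-(n : ℤ)) n, ∑ v ∈ Finset.Icc (-(n : ℤ)) n, Φ u.natAbs v.natAbs = _
  simp only [hrow]
  rw [sum_Icc_neg_natAbs (fun a => Φ a 0 + 2 * ∑ b ∈ Finset.Icc 1 n, Φ a b) n,
    Finset.sum_add_distrib, ← Finset.mul_sum, sum_Icc_sum_Icc_of_symm hsymm,
    Finset.sum_add_distrib, ← Finset.mul_sum, hax, hdiag, h00,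
    Finset.sum_congr rfl fun b _ => hsymm 0 b, hax]
  simp only [hΦ, Finset.sum_filter]
  ring

/-! ### Convergence and tail of the series -/

theorem trapeziumF_le {a b : ℝ} (ha : 0 < a) (hb : 0 ≤ b) (hba : b ≤ a) :
    trapeziumF a b ≤ 1 / a ^ 3 := by
  have hnum : 20 * a ^ 6 + 25 * a ^ 5 * b - 7 * a ^ 4 * b ^ 2 + 28 * a ^ 3 * b ^ 3
      - 20 * a ^ 2 * b ^ 4 + 3 * a * b ^ 5 - b ^ 6 ≤ 240 * a ^ 6 := by
    have h1 : a ^ 5 * b ≤ a ^ 5 * a := by gcongr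
    have h2 : a ^ 3 * b ^ 3 ≤ a ^ 3 * a ^ 3 := by gcongr
    have h3 : a * b ^ 5 ≤ a * a ^ 5 := by gcongr
    have h4 : 0 ≤ a ^ 4 * b ^ 2 := by positivity
    have h5 : 0 ≤ a ^ 2 * b ^ 4 := by positivity
    have h6 : 0 ≤ b ^ 6 := by positivity
    have h7 : 0 ≤ a ^ 6 := by positivity
    linarith
  rw [trapeziumF, div_le_div_iff₀ (by positivity) (by positivity)]
  calc _ ≤ 240 * a ^ 6 * a ^ 3 := by gcongr
    _ = 240 * a ^ 5 * a ^ 2 * a ^ 2 := by ring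
    _ ≤ 240 * a ^ 5 * (a + b) ^ 2 * (a ^ 2 + b ^ 2) := by
        gcongr
        · linarith
        · nlinarith
    _ = _ := by ring

theorem three_add_neg_one_pow_bounds (k : ℕ) :
    (0 : ℝ) ≤ 2 * (3 + (-1 : ℝ) ^ k) ∧ 2 * (3 + (-1 : ℝ) ^ k) ≤ 8 := by
  rcases neg_one_pow_eq_or ℝ k with h | h <;> rw [h] <;> norm_num

theorem trapeziumTerm_nonneg (a : ℕ) : 0 ≤ trapeziumTerm a := by
  refine Finset.sum_nonneg fun b hb => ?_
  rw [Finset.mem_filter, Finset.mem_Ico] at hb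
  have : (b : ℝ) ≤ a := by exact_mod_cast hb.1.2.le
  exact mul_nonneg (three_add_neg_one_pow_bounds _).1
    (trapeziumF_nonneg (by positivity) (by positivity) this)

theorem card_coprime_Ico_le (a : ℕ) :
    ((Finset.Ico 1 a).filter (fun b => Nat.gcd a b = 1)).card ≤ a :=
  (Finset.card_filter_le _ _).trans ((Nat.card_Ico 1 a).trans_le (Nat.sub_le _ _))

theorem trapeziumTerm_le {a : ℕ} (ha : 1 ≤ a) : trapeziumTerm a ≤ 8 / (a : ℝ) ^ 2 := by
  have ha0 : (0 : ℝ) < a := by exact_mod_cast ha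
  have hterm : ∀ b ∈ (Finset.Ico 1 a).filter (fun b => Nat.gcd a b = 1),
      2 * (3 + (-1 : ℝ) ^ (a + b)) * trapeziumF a b ≤ 8 * (1 / (a : ℝ) ^ 3) := by
    intro b hb
    rw [Finset.mem_filter, Finset.mem_Ico] at hb
    have hba : (b : ℝ) ≤ a := by exact_mod_cast hb.1.2.le
    exact mul_le_mul (three_add_neg_one_pow_bounds _).2
      (trapeziumF_le ha0 (by positivity) hba) (trapeziumF_nonneg ha0.le (by positivity) hba)
      (by norm_num)
  refine (Finset.sum_le_card_nsmul _ _ _ hterm).trans ?_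
  rw [nsmul_eq_mul]
  calc _ ≤ (a : ℝ) * (8 * (1 / (a : ℝ) ^ 3)) := by
        gcongr
        exact card_coprime_Ico_le a
    _ = 8 / (a : ℝ) ^ 2 := by field_simp

/-- The new term is at most `8 / (M + 2) ^ 2`, which is less than the telescoping difference `8 / (M
+ 1) - 8 / (M + 2)`. This gives both summability and the tail bound. -/
theorem antitone_sum_trapeziumTerm_add :
    Antitone fun M : ℕ => ∑ k ∈ Finset.range M, trapeziumTerm (k + 2) + 8 / ((M : ℝ) + 1) := by
  refine antitone_nat_of_succ_le fun M => ?_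
  rw [Finset.sum_range_succ]
  have h := trapeziumTerm_le (a := M + 2) (by omega)
  have h2 : 8 / (((M + 2 : ℕ) : ℝ)) ^ 2 ≤ 8 / ((M : ℝ) + 1) - 8 / (((M + 1 : ℕ) : ℝ) + 1) := by
    push_cast
    rw [div_sub_div _ _ (by positivity) (by positivity),
      div_le_div_iff₀ (by positivity) (by positivity)]
    have : (0 : ℝ) ≤ M := by positivity
    nlinarith
  linarith

theorem sum_trapeziumTerm_le (M N : ℕ) :
    ∑ k ∈ Finset.range M, trapeziumTerm (k + 2) ≤
      ∑ k ∈ Finset.range N, trapeziumTerm (k + 2) + 8 / ((N : ℝ) + 1) := by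
  rcases le_total N M with h | h
  · have h1 := antitone_sum_trapeziumTerm_add h
    have h2 : (0 : ℝ) ≤ 8 / ((M : ℝ) + 1) := by positivity
    simp only at h1
    linarith
  · have h1 := Finset.sum_le_sum_of_subset_of_nonneg (f := fun k => trapeziumTerm (k + 2))
      (Finset.range_mono h) fun k _ _ => trapeziumTerm_nonneg _
    have h2 : (0 : ℝ) ≤ 8 / ((N : ℝ) + 1) := by positivity
    linarith

theorem summable_trapeziumTerm : Summable fun k : ℕ => trapeziumTerm (k + 2) :=
  summable_of_sum_range_le (fun _ => trapeziumTerm_nonneg _) fun M => sum_trapeziumTerm_le M 0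

theorem abs_trapeziumGamma_sub_le {n : ℕ} (hn : 1 ≤ n) :
    |trapeziumGamma - (4 / 15 + ∑ a ∈ Finset.Icc 1 n, trapeziumTerm a)| ≤ 8 / (n : ℝ) := by
  obtain ⟨N, rfl⟩ : ∃ N, n = N + 1 := ⟨n - 1, by omega⟩
  have hsum : ∑ a ∈ Finset.Icc 1 (N + 1), trapeziumTerm a =
      ∑ k ∈ Finset.range N, trapeziumTerm (k + 2) := by
    rw [← Finset.add_sum_Ioc_eq_sum_Icc (by omega), show trapeziumTerm 1 = 0 by simp [trapeziumTerm],
      zero_add]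
    refine (Finset.sum_nbij (fun k => k + 2) ?_ ?_ ?_ fun _ _ => rfl).symm
    · intro k hk
      rw [Finset.mem_range] at hk
      rw [Finset.mem_Ioc]
      omega
    · intro x _ y _ hxy
      simpa using hxy
    · intro a ha
      rw [Finset.mem_coe, Finset.mem_Ioc] at ha
      exact ⟨a - 2, by simp only [Finset.coe_range, Set.mem_Iio]; omega, by simp only; omega⟩
  have h1 := Real.tsum_le_of_sum_range_le (f := fun k => trapeziumTerm (k + 2))
    (fun _ => trapeziumTerm_nonneg _) fun M => sum_trapeziumTerm_le M N
  have h2 := summable_trapeziumTerm.sum_le_tsum (Finset.range N) fun _ _ => trapeziumTerm_nonneg _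
  rw [hsum, trapeziumGamma, abs_le]
  have h3 : (0 : ℝ) ≤ 8 / ((N : ℝ) + 1) := by positivity
  push_cast
  constructor <;> linarith

/-! ### Assembly of the main term and the error -/

theorem abs_sum_coprime_shapeSum_sub_le {e n : ℕ} (he : e ≤ 2) (hn : 1 ≤ n) :
    |4 * shapeSum e n 1 0 + 4 * shapeSum e n 1 1 +
        8 * (∑ a ∈ Finset.Icc 1 n, ∑ b ∈ (Finset.Ico 1 a).filter (fun b => Nat.gcd a b = 1),
          shapeSum e n a b) -
      (4 / 15 + ∑ a ∈ Finset.Icc 1 n, trapeziumTerm a) * (n : ℝ) ^ 5| ≤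
      1536 * (n : ℝ) ^ 4 * (2 + Real.log n) := by
  have e0 := abs_shapeSum_sub_le (b := 0) he le_rfl hn (by omega)
  have e1 := abs_shapeSum_sub_le (b := 1) he le_rfl hn le_rfl
  -- The axis directions give `4 * (1 / 2) * (1 / 12) = 1 / 6` and the diagonal ones `4 * (1 / 40) =
  -- 1 / 10`; together these are `4 / 15`.
  rw [show trapeziumF ((1 : ℕ) : ℝ) ((0 : ℕ) : ℝ) = 1 / 12 by norm_num [trapeziumF]] at e0
  rw [show trapeziumF ((1 : ℕ) : ℝ) ((1 : ℕ) : ℝ) = 1 / 40 by norm_num [trapeziumF]] at e1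
  norm_num at e0 e1
  have hrest : |8 * (∑ a ∈ Finset.Icc 1 n, ∑ b ∈ (Finset.Ico 1 a).filter
      (fun b => Nat.gcd a b = 1), shapeSum e n a b) -
      (∑ a ∈ Finset.Icc 1 n, trapeziumTerm a) * (n : ℝ) ^ 5| ≤
      1536 * (n : ℝ) ^ 4 * (1 + Real.log n) := by
    have hinner : ∀ a ∈ Finset.Icc 1 n,
        |8 * (∑ b ∈ (Finset.Ico 1 a).filter (fun b => Nat.gcd a b = 1), shapeSum e n a b) -
          trapeziumTerm a * (n : ℝ) ^ 5| ≤ 1536 * (n : ℝ) ^ 4 * (a : ℝ)⁻¹ := by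
      intro a ha
      rw [Finset.mem_Icc] at ha
      have ha0 : (0 : ℝ) < a := by exact_mod_cast ha.1
      rw [trapeziumTerm, Finset.mul_sum, Finset.sum_mul, ← Finset.sum_sub_distrib]
      refine (Finset.abs_sum_le_sum_abs _ _).trans ?_
      refine (Finset.sum_le_card_nsmul _ _ (8 * (192 * ((n : ℝ) ^ 4 / (a : ℝ) ^ 2))) ?_).trans ?_
      · intro b hb
        rw [Finset.mem_filter, Finset.mem_Ico] at hb
        have := abs_shapeSum_sub_le (e := e) he ha.1 ha.2 hb.1.2.le
        rw [abs_le] at this ⊢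
        constructor <;> linarith [this.1, this.2]
      · rw [nsmul_eq_mul]
        -- At most `a` values of `b`, each with error of order `n ^ 4 / a ^ 2`, leave `n ^ 4 / a`;
        -- the harmonic sum over `a ≤ n` is the source of the logarithm.
        calc _ ≤ (a : ℝ) * (8 * (192 * ((n : ℝ) ^ 4 / (a : ℝ) ^ 2))) := by
              gcongr
              exact card_coprime_Ico_le a
          _ = 1536 * (n : ℝ) ^ 4 * (a : ℝ)⁻¹ := by field_simp; norm_num
    rw [Finset.mul_sum, Finset.sum_mul, ← Finset.sum_sub_distrib]
    refine (Finset.abs_sum_le_sum_abs _ _).trans ((Finset.sum_le_sum hinner).trans ?_)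
    rw [← Finset.mul_sum]
    gcongr
    have := harmonic_le_one_add_log n
    rw [harmonic_eq_sum_Icc] at this
    push_cast at this
    exact this
  rw [abs_le] at e0 e1 hrest ⊢
  constructor <;> linarith [e0.1, e0.2, e1.1, e1.2, hrest.1, hrest.2]

theorem lemma4p4 :
    (Summable fun k : ℕ => trapeziumTerm (k + 2)) ∧
      (fun n : ℕ => (numIsoscelesTrapezia n : ℝ) - trapeziumGamma * (n : ℝ) ^ 5)
        =O[atTop] fun n : ℕ => (n : ℝ) ^ 4 * Real.log n := by
  -- Once `1 ≤ log n`, the error `1536 * (2 + log n)` is at most `4608 * log n`, and the tail of the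
  -- series adds `8`.
  refine ⟨summable_trapeziumTerm, IsBigO.of_bound 4616 ?_⟩
  filter_upwards [eventually_ge_atTop 3] with n hn
  have hn1 : 1 ≤ n := by omega
  have hn0 : (0 : ℝ) < n := by exact_mod_cast hn1
  have hn3 : (3 : ℝ) ≤ n := by exact_mod_cast hn
  have hlog : 1 ≤ Real.log n := by
    rw [Real.le_log_iff_exp_le hn0]
    linarith [Real.exp_one_lt_d9]
  have hup : (numIsoscelesTrapezia n : ℝ) ≤ _ :=
    (Nat.cast_le.2 (numIsoscelesTrapezia_le_sum n)).trans_eq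
      ((sum_card_shapePositions (e := 0) (by decide) n).trans (sum_coprime_shapeSum 0 hn1))
  have hlow : _ ≤ (numIsoscelesTrapezia n : ℝ) :=
    ((sum_card_shapePositions (e := 2) (by decide) n).trans
      (sum_coprime_shapeSum 2 hn1)).symm.trans_le
      (Nat.cast_le.2 (sum_le_numIsoscelesTrapezia n))
  have a0 := abs_sum_coprime_shapeSum_sub_le (e := 0) (by norm_num) hn1
  have a2 := abs_sum_coprime_shapeSum_sub_le (e := 2) le_rfl hn1
  have hγ : |trapeziumGamma * (n : ℝ) ^ 5 -
      (4 / 15 + ∑ a ∈ Finset.Icc 1 n, trapeziumTerm a) * (n : ℝ) ^ 5| ≤ 8 * (n : ℝ) ^ 4 := by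
    rw [← sub_mul, abs_mul, abs_of_nonneg (by positivity : (0 : ℝ) ≤ (n : ℝ) ^ 5)]
    calc _ ≤ 8 / (n : ℝ) * (n : ℝ) ^ 5 := by
          gcongr
          exact abs_trapeziumGamma_sub_le hn1
      _ = 8 * (n : ℝ) ^ 4 := by field_simp
  have hp : (0 : ℝ) < (n : ℝ) ^ 4 := by positivity
  have hmul : (n : ℝ) ^ 4 ≤ (n : ℝ) ^ 4 * Real.log n := le_mul_of_one_le_right hp.le hlog
  rw [Real.norm_eq_abs, Real.norm_of_nonneg (by positivity)]
  rw [abs_le] at a0 a2 hγ ⊢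
  constructor <;> linarith [a0.1, a0.2, a2.1, a2.2, hγ.1, hγ.2]
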